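/- A $b$-coloring of a finite simple graph $G$ with $k$ colors is a proper coloring $V(G)\to\{1,\dots,k\}$ such that for every color $i$ there is a vertex $x$ of color $i$ that has, for each color $j\neq i$, a neighbor of color $j$. The problem $b$-Coloring asks, given $G$ and an integer $k\ge 0$, whether $G$ has a $b$-coloring with $k$ colors. Let $n$ be the number of vertices of $G$, let $\Delta=\Delta(G)$ be its maximum degree, and let $\ell=\ell_k(G)$ be the number of vertices of $G$ of degree at least $k$. **Theorem.** $b$-Coloring is fixed-parameter tractable parameterized by $\Delta(G)+\ell_k(G)$: it can be decided in time $f(\Delta+\ell)\cdot N^{O(1)}$ for some computable function $f$, where $N$ is the length of the input. More precisely, there is an algorithm that, given $G$ and $k$, decides whether $G$ has a $b$-coloring with $k$ colors in time $$2^{O(\ell\cdot\Delta\cdot\min\{\ell,\Delta\}^{\ell+1})}+n^{O(1)}\quad\text{if } \ell>k,$$ $$2^{O(\min\{k,\Delta+1\}^4\cdot\Delta)}+n^{O(1)}\quad\text{if } \ell\le k.$$ (Algorithms are programs of a random access machine with addition and subtraction at unit cost; $n^{O(1)}$ is read as $(n+2)^{c}$ for a constant $c$, so that it also makes sense for $n\le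 1$.) -/

import Mathlib

/-! ## Random access machines

Structured programs for a uniform-cost random access machine.  The machine has registers and
arrays holding natural numbers (a program mentions only finitely many of them; they are addressed
by constants), array cells are addressed indirectly through registers, and the arithmetic is
restricted to addition and truncated subtraction, so that the model is polynomially equivalent to
Turing machines.  Every instruction and every test costs one step. -/

namespace RAM

/-- A memory configuration: `reg r` is the content of register `r`, and `arr a i` is the content
of cell `i` of array `a`. -/
structure State where
  reg : ℕ → ℕ
  arr : ℕ → ℕ → ℕ

/-- The state after the assignment of the value `v` to register `r`. -/
def State.setReg (s : State) (r v : ℕ) : State :=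
  { s with reg := Function.update s.reg r v }

/-- The state after the assignment of the value `v` to cell `i` of array `a`. -/
def State.setArr (s : State) (a i v : ℕ) : State :=
  { s with arr := Function.update s.arr a (Function.update (s.arr a) i v) }

/-- Programs. All arguments of type `ℕ` are names of registers, except `v` (a constant) and `a`
(the name of an array). -/
inductive Program where
  /-- do nothing -/
  | skip : Program
  /-- `r := v` for a constant `v` -/
  | const (r v : ℕ) : Program
  /-- `r := x` -/
  | copy (r x : ℕ) : Program
  /-- `r := x + y` -/
  | add (r x y : ℕ) : Program
  /-- `r := max (x - y) 0` -/
  | sub (r x y : ℕ) : Program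
  /-- `r := a[x]` -/
  | load (r a x : ℕ) : Program
  /-- `a[x] := y` -/
  | store (a x y : ℕ) : Program
  /-- `p; q` -/
  | seq (p q : Program) : Program
  /-- `if x < y then p else q` -/
  | ifLt (x y : ℕ) (p q : Program) : Program
  /-- `while x < y do p` -/
  | whileLt (x y : ℕ) (p : Program) : Program

/-- `Runs p s s' t`: started in the state `s`, the program `p` halts in the state `s'` after
exactly `t` steps. -/
inductive Runs : Program → State → State → ℕ → Prop where
  | skip (s : State) : Runs .skip s s 1
  | const (s : State) (r v : ℕ) : Runs (.const r v) s (s.setReg r v) 1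
  | copy (s : State) (r x : ℕ) : Runs (.copy r x) s (s.setReg r (s.reg x)) 1
  | add (s : State) (r x y : ℕ) : Runs (.add r x y) s (s.setReg r (s.reg x + s.reg y)) 1
  | sub (s : State) (r x y : ℕ) : Runs (.sub r x y) s (s.setReg r (s.reg x - s.reg y)) 1
  | load (s : State) (r a x : ℕ) : Runs (.load r a x) s (s.setReg r (s.arr a (s.reg x))) 1
  | store (s : State) (a x y : ℕ) : Runs (.store a x y) s (s.setArr a (s.reg x) (s.reg y)) 1
  | seq {p q : Program} {s₁ s₂ s₃ : State} {t₁ t₂ : ℕ} (hp : Runs p s₁ s₂ t₁)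
      (hq : Runs q s₂ s₃ t₂) : Runs (.seq p q) s₁ s₃ (t₁ + t₂)
  | ifTrue {x y : ℕ} {p q : Program} {s s' : State} {t : ℕ} (h : s.reg x < s.reg y)
      (hp : Runs p s s' t) : Runs (.ifLt x y p q) s s' (t + 1)
  | ifFalse {x y : ℕ} {p q : Program} {s s' : State} {t : ℕ} (h : ¬ s.reg x < s.reg y)
      (hq : Runs q s s' t) : Runs (.ifLt x y p q) s s' (t + 1)
  | whileTrue {x y : ℕ} {p : Program} {s₁ s₂ s₃ : State} {t₁ t₂ : ℕ} (h : s₁.reg x < s₁.reg y)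
      (hp : Runs p s₁ s₂ t₁) (hw : Runs (.whileLt x y p) s₂ s₃ t₂) :
      Runs (.whileLt x y p) s₁ s₃ (t₁ + t₂ + 1)
  | whileFalse {x y : ℕ} {p : Program} {s : State} (h : ¬ s.reg x < s.reg y) :
      Runs (.whileLt x y p) s s 1

/-- Started in the state `s`, the program `p` halts after at most `T` steps, with the answer `1`
in register `0` if `Q` holds and the answer `0` there if `Q` fails. -/
def DecidesInTime (p : Program) (s : State) (Q : Prop) (T : ℕ) : Prop :=
  ∃ (s' : State) (t : ℕ), Runs p s s' t ∧ t ≤ T ∧ (Q → s'.reg 0 = 1) ∧ (¬ Q → s'.reg 0 = 0)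

/-- Fixed-parameter tractability of the problem "does `Q x` hold?" on instances `x : α`, where
`input x` is the initial memory holding the instance, `length x` is its length and `param x` is
its parameter. -/
def IsFPT {α : Type*} (input : α → State) (length param : α → ℕ) (Q : α → Prop) : Prop :=
  ∃ (p : Program) (f : ℕ → ℕ) (c : ℕ), Computable f ∧
    ∀ x : α, DecidesInTime p (input x) (Q x) (f (param x) * length x ^ c)

end RAM

/-! ## The problem -/

/-- `G` admits a `b`-coloring with `k` colors: a proper coloring in which every color `i` has a
vertex `x` of color `i` with a neighbor in each of the other color classes. -/
def HasBColoring {V : Type*} (G : SimpleGraph V) (k : ℕ) : Prop :=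
  ∃ C : G.Coloring (Fin k), ∀ i : Fin k, ∃ x : V, C x = i ∧
    ∀ j : Fin k, j ≠ i → ∃ y : V, G.Adj x y ∧ C y = j

open Classical in
/-- The maximum degree `Δ(G)`. -/
noncomputable def maxDeg {V : Type*} [Fintype V] (G : SimpleGraph V) : ℕ :=
  G.maxDegree

open Classical in
/-- The number `ℓ_k(G)` of vertices of degree at least `k`. -/
noncomputable def numHighDeg {V : Type*} [Fintype V] (G : SimpleGraph V) (k : ℕ) : ℕ :=
  (Finset.univ.filter fun v : V => k ≤ G.degree v).card

/-- An instance of `b`-Coloring: a finite simple graph with vertices `0, …, n - 1`, and the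
number `k` of colors. -/
structure BInstance where
  n : ℕ
  G : SimpleGraph (Fin n)
  k : ℕ

namespace BInstance

open Classical in
/-- The initial memory: register `0` holds `n`, register `1` holds `k`, and array `0` holds the
adjacency matrix, row by row, with the entry for `(i, j)` in cell `i * n + j`. Everything else
is `0`. -/
noncomputable def input (I : BInstance) : RAM.State where
  reg r := if r = 0 then I.n else if r = 1 then I.k else 0
  arr a m := if a = 0 ∧ ∃ i j : Fin I.n, I.G.Adj i j ∧ m = i * I.n + j then 1 else 0

/-- The length of an instance: the bits of the adjacency matrix, the bits of `k`, and an
end marker. -/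
def length (I : BInstance) : ℕ := I.n ^ 2 + Nat.size I.k + 1

end BInstance

/-! A vertex realising its color has neighbors in `k - 1` other colors, so its degree is at least `k
- 1`; hence `k ≤ Δ + 1`, and such a vertex is either high (degree at least `k`) or tight (degree
exactly `k - 1`). Vertices that are not high can always be colored greedily, so a `b`-coloring
exists as soon as a consistent partial coloring covers the high vertices, one `b`-vertex per color
and the neighbors witnessing it (`IsPartialColoring.exists_coloring`).

There are `ℓ` high vertices, but possibly many tight ones. If there are at least `(ℓ + k)(Δ + 1)³`
tight vertices, then `k` of them can be picked at distance more than three from each other and from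
all high vertices. Coloring each closed neighborhood with all `k` colors, and keeping a given proper
coloring on the high vertices, creates no conflict (`exists_bColoring_of_card_le`). So only that
many tight vertices need be considered as `b`-vertices (`exists_bColoring_cand`).

The search runs over three numbers whose digits encode the colors of high vertices, the choice of
`b`-vertices and the choice of witnesses; `accept_iff` says that it succeeds exactly on the
yes-instances. The predicates `Comp` and `CompPred` are closed under arithmetic, bounded quantifiers
and iteration, which gives a program polynomial in `n` and the sizes of the three ranges. Estimating
these sizes by powers of two yields both time bounds. -/

namespace RAM

/-! ## Functions computable in time polynomial in a bound -/

/-- A context: data `x : α` kept in finitely many registers and in array `0`, together with the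
bound in which the running times are measured. -/
class Context (α : Type) where
  /-- the number of registers -/
  size : ℕ
  /-- the contents of the registers -/
  regs : α → ℕ → ℕ
  /-- the content of array `0` -/
  cells : α → ℕ → ℕ
  /-- the bound in which times and values are measured -/
  bound : α → ℕ
  two_le_bound : ∀ x, 2 ≤ bound x

open Context

/-- A loop counter or quantified variable becomes one more register. It enters the bound through the
maximum, so a body polynomial in the extended bound stays polynomial in the old one when the
variable takes polynomially bounded values. -/
instance Context.prod {α : Type} [Context α] : Context (α × ℕ) where
  size := size α + 1
  regs x i := if i = size α then x.2 else regs x.1 i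
  cells x := cells x.1
  bound x := max (bound x.1) x.2
  two_le_bound x := (two_le_bound x.1).trans (le_max_left _ _)

variable {α : Type} [Context α]

/-- `f` is bounded by a polynomial in the bound of the context. -/
def PolyBounded (f : α → ℕ) : Prop := ∃ c, ∀ x, f x ≤ bound x ^ c

namespace PolyBounded

theorem mono {f g : α → ℕ} (hg : PolyBounded g) (h : ∀ x, f x ≤ g x) : PolyBounded f :=
  let ⟨c, hc⟩ := hg
  ⟨c, fun x => (h x).trans (hc x)⟩

theorem const (v : ℕ) : PolyBounded fun _ : α => v :=
  ⟨v, fun x => (Nat.lt_two_pow_self).le.trans (Nat.pow_le_pow_left (two_le_bound x) v)⟩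

theorem mul {f g : α → ℕ} (hf : PolyBounded f) (hg : PolyBounded g) :
    PolyBounded fun x => f x * g x := by
  obtain ⟨a, ha⟩ := hf
  obtain ⟨b, hb⟩ := hg
  exact ⟨a + b, fun x => by rw [pow_add]; exact Nat.mul_le_mul (ha x) (hb x)⟩

theorem add {f g : α → ℕ} (hf : PolyBounded f) (hg : PolyBounded g) :
    PolyBounded fun x => f x + g x := by
  obtain ⟨a, ha⟩ := hf
  obtain ⟨b, hb⟩ := hg
  refine ⟨a + b + 1, fun x => ?_⟩
  have h2 := two_le_bound x
  have h1 : 1 ≤ bound x := by omega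
  have h3 := Nat.pow_le_pow_right h1 (Nat.le_add_right a b)
  have h4 := Nat.pow_le_pow_right h1 (Nat.le_add_left b a)
  calc f x + g x ≤ bound x ^ (a + b) + bound x ^ (a + b) :=
        Nat.add_le_add ((ha x).trans h3) ((hb x).trans h4)
    _ = bound x ^ (a + b) * 2 := by ring
    _ ≤ bound x ^ (a + b) * bound x := Nat.mul_le_mul_left _ h2
    _ = bound x ^ (a + b + 1) := (pow_succ _ _).symm

theorem pow_const {f : α → ℕ} (hf : PolyBounded f) (e : ℕ) : PolyBounded fun x => f x ^ e := by
  obtain ⟨a, ha⟩ := hf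
  exact ⟨a * e, fun x => by rw [pow_mul]; exact Nat.pow_le_pow_left (ha x) e⟩

theorem of_bound : PolyBounded (bound : α → ℕ) := ⟨1, fun x => by simp⟩

end PolyBounded

/-- The program `p` computes `f x` in time `T x` into the register `d`, when the data `x` is found
in the registers given by `loc`. Registers below `d` and arrays are left unchanged. -/
def Computes (p : Program) (loc : ℕ → ℕ) (d : ℕ) (f T : α → ℕ) : Prop :=
  ∀ (x : α) (s : State), (∀ i < size α, s.reg (loc i) = regs x i) → s.arr 0 = cells x →
    ∃ s' t, Runs p s s' t ∧ t ≤ T x ∧ s'.reg d = f x ∧ (∀ r < d, s'.reg r = s.reg r) ∧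
      s'.arr = s.arr

/-- `f` is polynomially bounded, and computable in polynomially bounded time. -/
def Comp (f : α → ℕ) : Prop :=
  PolyBounded f ∧ ∃ T : α → ℕ, PolyBounded T ∧
    ∀ (loc : ℕ → ℕ) (d : ℕ), (∀ i < size α, loc i < d) → ∃ p, Computes p loc d f T

open Classical in
/-- The predicate `P` is decidable in polynomially bounded time. -/
def CompPred (P : α → Prop) : Prop := Comp fun x => if P x then 1 else 0

namespace Comp

theorem of_eq {f g : α → ℕ} (hf : Comp f) (h : ∀ x, f x = g x) : Comp g :=
  (funext h : f = g) ▸ hf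

theorem const (v : ℕ) : Comp fun _ : α => v := by
  refine ⟨.const v, _, .const 1, fun loc d _ => ⟨.const d v, fun x s _ _ =>
    ⟨_, _, .const s d v, le_rfl, ?_, ?_, rfl⟩⟩⟩
  · simp [State.setReg]
  · intro r hr
    simp [State.setReg, hr.ne]

theorem register {f : α → ℕ} (hb : PolyBounded f) (i : ℕ) (hi : i < size α)
    (h : ∀ x, regs x i = f x) : Comp f := by
  refine ⟨hb, _, .const 1, fun loc d _ => ⟨.copy d (loc i), fun x s hs _ =>
    ⟨_, _, .copy s d _, le_rfl, ?_, ?_, rfl⟩⟩⟩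
  · simp [State.setReg, hs i hi, h]
  · intro r hr
    simp [State.setReg, hr.ne]

theorem fst {f : α → ℕ} (hf : Comp f) : Comp fun x : α × ℕ => f x.1 := by
  obtain ⟨⟨c, hc⟩, T, ⟨e, he⟩, hp⟩ := hf
  refine ⟨⟨c, fun x => (hc x.1).trans (Nat.pow_le_pow_left (le_max_left _ _) c)⟩,
    fun x => T x.1, ⟨e, fun x => (he x.1).trans (Nat.pow_le_pow_left (le_max_left _ _) e)⟩,
    fun loc d hd => ?_⟩
  obtain ⟨p, hp⟩ := hp loc d fun i hi => hd i (Nat.lt_succ_of_lt hi)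
  refine ⟨p, fun x s hs hA => hp x.1 s (fun i hi => ?_) hA⟩
  rw [hs i (Nat.lt_succ_of_lt hi)]
  exact if_neg hi.ne

theorem snd : Comp fun x : α × ℕ => x.2 :=
  register ⟨1, fun x => by simp [bound]⟩ (size α) (Nat.lt_succ_self _) fun x => if_pos rfl

/-- Two computations followed by an instruction combining the results. -/
theorem binary {f g h : α → ℕ} (hf : Comp f) (hg : Comp g) (hh : PolyBounded h)
    (op : ℕ → Program)
    (hop : ∀ (x : α) (s : State) (d : ℕ), s.reg d = f x → s.reg (d + 1) = g x →
      Runs (op d) s (s.setReg d (h x)) 1) : Comp h := by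
  obtain ⟨_, Tf, hTf, hf⟩ := hf
  obtain ⟨_, Tg, hTg, hg⟩ := hg
  refine ⟨hh, fun x => Tf x + (Tg x + 1), hTf.add (hTg.add (.const 1)), fun loc d hd => ?_⟩
  obtain ⟨p, hp⟩ := hf loc d hd
  -- Working from `d + 1` upward, the second program preserves the first result, which sits in `d`.
  obtain ⟨q, hq⟩ := hg loc (d + 1) fun i hi => Nat.lt_succ_of_lt (hd i hi)
  refine ⟨.seq p (.seq q (op d)), fun x s hs hA => ?_⟩
  obtain ⟨s₁, t₁, r₁, ht₁, hv₁, hr₁, ha₁⟩ := hp x s hs hA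
  obtain ⟨s₂, t₂, r₂, ht₂, hv₂, hr₂, ha₂⟩ := hq x s₁
    (fun i hi => by rw [hr₁ _ (hd i hi), hs i hi]) (by rw [ha₁, hA])
  refine ⟨_, _, .seq r₁ (.seq r₂ (hop x s₂ d (by rw [hr₂ d (Nat.lt_succ_self d), hv₁]) hv₂)),
    by beta_reduce; omega, by simp [State.setReg], fun r hr => ?_, by simp [State.setReg, ha₂, ha₁]⟩
  simp [State.setReg, hr.ne, hr₂ r (by omega), hr₁ r hr]

theorem add {f g : α → ℕ} (hf : Comp f) (hg : Comp g) : Comp fun x => f x + g x :=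
  binary hf hg (hf.1.add hg.1) (fun d => .add d d (d + 1)) fun x s d h₁ h₂ => by
    rw [← h₁, ← h₂]; exact .add s d d (d + 1)

theorem sub {f g : α → ℕ} (hf : Comp f) (hg : Comp g) : Comp fun x => f x - g x :=
  binary hf hg (hf.1.mono fun _ => Nat.sub_le _ _) (fun d => .sub d d (d + 1))
    fun x s d h₁ h₂ => by rw [← h₁, ← h₂]; exact .sub s d d (d + 1)

theorem load {f : α → ℕ} (hf : Comp f) (hb : PolyBounded fun x => cells x (f x)) :
    Comp fun x => cells x (f x) := by
  refine ⟨hb, ?_⟩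
  obtain ⟨_, T, hT, hf⟩ := hf
  refine ⟨fun x => T x + 1, hT.add (.const 1), fun loc d hd => ?_⟩
  obtain ⟨p, hp⟩ := hf loc d hd
  refine ⟨.seq p (.load d 0 d), fun x s hs hA => ?_⟩
  obtain ⟨s₁, t₁, r₁, ht₁, hv₁, hr₁, ha₁⟩ := hp x s hs hA
  refine ⟨_, _, .seq r₁ (.load s₁ d 0 d), by beta_reduce; omega, ?_, fun r hr => ?_, by
    simp [State.setReg, ha₁]⟩
  · simp [State.setReg, hv₁, ha₁, hA]
  · simp [State.setReg, hr.ne, hr₁ r hr]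

theorem ite_lt {f g u v : α → ℕ} (hf : Comp f) (hg : Comp g) (hu : Comp u) (hv : Comp v) :
    Comp fun x => if f x < g x then u x else v x := by
  have hb : PolyBounded fun x => if f x < g x then u x else v x :=
    (hu.1.add hv.1).mono fun x => by split <;> omega
  refine ⟨hb, ?_⟩
  obtain ⟨_, Tf, hTf, hf⟩ := hf
  obtain ⟨_, Tg, hTg, hg⟩ := hg
  obtain ⟨_, Tu, hTu, hu⟩ := hu
  obtain ⟨_, Tv, hTv, hv⟩ := hv
  refine ⟨fun x => Tf x + (Tg x + (Tu x + Tv x + 1)),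
    hTf.add (hTg.add ((hTu.add hTv).add (.const 1))), fun loc d hd => ?_⟩
  obtain ⟨p, hp⟩ := hf loc d hd
  obtain ⟨q, hq⟩ := hg loc (d + 1) fun i hi => Nat.lt_succ_of_lt (hd i hi)
  obtain ⟨p', hp'⟩ := hu loc d hd
  obtain ⟨q', hq'⟩ := hv loc d hd
  refine ⟨.seq p (.seq q (.ifLt d (d + 1) p' q')), fun x s hs hA => ?_⟩
  obtain ⟨s₁, t₁, r₁, ht₁, hv₁, hr₁, ha₁⟩ := hp x s hs hA
  obtain ⟨s₂, t₂, r₂, ht₂, hv₂, hr₂, ha₂⟩ := hq x s₁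
    (fun i hi => by rw [hr₁ _ (hd i hi), hs i hi]) (by rw [ha₁, hA])
  have hs₂ : ∀ i < size α, s₂.reg (loc i) = regs x i := fun i hi => by
    rw [hr₂ _ (Nat.lt_succ_of_lt (hd i hi)), hr₁ _ (hd i hi), hs i hi]
  have hA₂ : s₂.arr 0 = cells x := by rw [ha₂, ha₁, hA]
  have hd₂ : s₂.reg d = f x := by rw [hr₂ d (Nat.lt_succ_self d), hv₁]
  by_cases hlt : f x < g x
  · obtain ⟨s₃, t₃, r₃, ht₃, hv₃, hr₃, ha₃⟩ := hp' x s₂ hs₂ hA₂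
    refine ⟨s₃, _, .seq r₁ (.seq r₂ (.ifTrue (by rwa [hd₂, hv₂]) r₃)), by beta_reduce; omega,
      by simp [hlt, hv₃], fun r hr => ?_, by rw [ha₃, ha₂, ha₁]⟩
    rw [hr₃ r hr, hr₂ r (by omega), hr₁ r hr]
  · obtain ⟨s₃, t₃, r₃, ht₃, hv₃, hr₃, ha₃⟩ := hq' x s₂ hs₂ hA₂
    refine ⟨s₃, _, .seq r₁ (.seq r₂ (.ifFalse (by rwa [hd₂, hv₂]) r₃)), by beta_reduce; omega,
      by simp [hlt, hv₃], fun r hr => ?_, by rw [ha₃, ha₂, ha₁]⟩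
    rw [hr₃ r hr, hr₂ r (by omega), hr₁ r hr]

/-- Iteration: a loop with a counter and an accumulator whose values stay polynomially bounded. -/
theorem iterate {m a : α → ℕ} {b : (α × ℕ) × ℕ → ℕ} {F : α → ℕ → ℕ} {A : α → ℕ}
    (hm : Comp m) (ha : Comp a) (hb : Comp b) (hA : PolyBounded A)
    (hFA : ∀ x, ∀ i ≤ m x, F x i ≤ A x) (h0 : ∀ x, F x 0 = a x)
    (hF : ∀ x, ∀ i < m x, F x (i + 1) = b ((x, i), F x i)) : Comp fun x => F x (m x) := by
  refine ⟨hA.mono fun x => hFA x _ le_rfl, ?_⟩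
  obtain ⟨hmb, Tm, hTm, hm⟩ := hm
  obtain ⟨_, Ta, hTa, ha⟩ := ha
  obtain ⟨_, Tb, ⟨e, hTb⟩, hb⟩ := hb
  -- The bound of the extended context at `((x, i), F x i)` is a maximum of three terms, at most
  -- `bound x + m x + A x`; so `S` bounds the time of every execution of the body.
  let S : α → ℕ := fun x => (bound x + m x + A x) ^ e
  have hS : PolyBounded S := ((PolyBounded.of_bound.add hmb).add hA).pow_const e
  have hTS : ∀ x, ∀ i ≤ m x, Tb ((x, i), F x i) ≤ S x := fun x i hi =>
    (hTb _).trans (Nat.pow_le_pow_left (by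
      have := hFA x i hi
      change max (max (bound x) i) (F x i) ≤ _
      omega) e)
  refine ⟨fun x => Ta x + (Tm x + (1 + (1 + (m x * (S x + 3) + 1)))),
    hTa.add (hTm.add ((PolyBounded.const 1).add ((PolyBounded.const 1).add
      ((hmb.mul (hS.add (.const 3))).add (.const 1))))), fun loc d hd => ?_⟩
  obtain ⟨p, hp⟩ := ha loc d hd
  obtain ⟨q, hq⟩ := hm loc (d + 1) fun i hi => Nat.lt_succ_of_lt (hd i hi)
  -- Register layout: accumulator in `d`, number of rounds in `d + 1`, counter in `d + 2`, the
  -- constant 1 in `d + 3`, and the body works from `d + 4` on.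
  let loc' : ℕ → ℕ := fun i => if i = size α + 1 then d else if i = size α then d + 2 else loc i
  obtain ⟨w, hw⟩ := hb loc' (d + 4) (by
    intro i hi
    change i < size α + 1 + 1 at hi
    simp only [loc']
    split
    · omega
    · split
      · omega
      · have := hd i (by omega)
        omega)
  let body : Program := .seq w (.seq (.copy d (d + 4)) (.add (d + 2) (d + 2) (d + 3)))
  refine ⟨.seq p (.seq q (.seq (.const (d + 2) 0) (.seq (.const (d + 3) 1)
    (.whileLt (d + 2) (d + 1) body)))), fun x s hs hc => ?_⟩
  -- Induction on the number `j` of remaining rounds; each costs the body plus the copy, the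
  -- increment and the test.
  have loop : ∀ j i, i + j = m x → ∀ s₁ : State, (∀ r < d, s₁.reg r = s.reg r) →
      s₁.arr = s.arr → s₁.reg d = F x i → s₁.reg (d + 1) = m x → s₁.reg (d + 2) = i →
      s₁.reg (d + 3) = 1 → ∃ s' t, Runs (.whileLt (d + 2) (d + 1) body) s₁ s' t ∧
        t ≤ j * (S x + 3) + 1 ∧ s'.reg d = F x (m x) ∧ (∀ r < d, s'.reg r = s.reg r) ∧
        s'.arr = s.arr := by
    intro j
    induction j with
    | zero =>
      intro i hi s₁ hr harr hacc hm hcnt _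
      refine ⟨s₁, 1, .whileFalse (by rw [hm, hcnt]; omega), by omega, ?_, hr, harr⟩
      rw [hacc, show i = m x by omega]
    | succ j ih =>
      intro i hi s₁ hr harr hacc hm hcnt hone
      obtain ⟨s₂, t₂, r₂, ht₂, hv₂, hr₂, ha₂⟩ := hw ((x, i), F x i) s₁ (by
        intro l hl
        change l < size α + 1 + 1 at hl
        change s₁.reg (loc' l) = if l = size α + 1 then F x i else
          if l = size α then i else regs x l
        simp only [loc']
        split_ifs with h₁ h₂
        · exact hacc
        · exact hcnt
        · have hl' : l < size α := by omega
          rw [hr _ (hd l hl'), hs l hl']) (by rw [harr]; exact hc)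
      have hT := ht₂.trans (hTS x i (by omega))
      let s₃ := s₂.setReg d (s₂.reg (d + 4))
      let s₄ := s₃.setReg (d + 2) (s₃.reg (d + 2) + s₃.reg (d + 3))
      have hne : ∀ r < d, r ≠ d ∧ r ≠ d + 2 := fun r hr => ⟨by omega, by omega⟩
      obtain ⟨s', t', r', ht', hv', hr', ha'⟩ := ih (i + 1) (by omega) s₄
        (fun r hlt => by
          simp [s₄, s₃, State.setReg, hne r hlt, hr₂ r (by omega), hr r hlt])
        (by simp [s₄, s₃, State.setReg, ha₂, harr])
        (by simp [s₄, s₃, State.setReg, hv₂, hF x i (by omega)])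
        (by simp [s₄, s₃, State.setReg, hr₂ (d + 1) (by omega), hm])
        (by simp [s₄, s₃, State.setReg, hr₂ (d + 2) (by omega), hr₂ (d + 3) (by omega), hcnt,
              hone])
        (by simp [s₄, s₃, State.setReg, hr₂ (d + 3) (by omega), hone])
      refine ⟨s', _, .whileTrue (by rw [hm, hcnt]; omega) (.seq r₂ (.seq (.copy s₂ d (d + 4))
        (.add s₃ (d + 2) (d + 2) (d + 3)))) r', ?_, hv', hr', ha'⟩
      rw [Nat.succ_mul]
      omega
  obtain ⟨s₁, t₁, r₁, ht₁, hv₁, hr₁, ha₁⟩ := hp x s hs hc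
  obtain ⟨s₂, t₂, r₂, ht₂, hv₂, hr₂, ha₂⟩ := hq x s₁
    (fun i hi => by rw [hr₁ _ (hd i hi), hs i hi]) (by rw [ha₁, hc])
  let s₃ := s₂.setReg (d + 2) 0
  let s₄ := s₃.setReg (d + 3) 1
  have hne : ∀ r < d, r ≠ d + 2 ∧ r ≠ d + 3 := fun r hr => ⟨by omega, by omega⟩
  obtain ⟨s', t', r', ht', hv', hr', ha'⟩ := loop (m x) 0 (by omega) s₄
    (fun r hlt => by
      simp [s₄, s₃, State.setReg, hne r hlt, hr₂ r (by omega), hr₁ r hlt])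
    (by simp [s₄, s₃, State.setReg, ha₂, ha₁])
    (by simp [s₄, s₃, State.setReg, hr₂ d (by omega), hv₁, h0])
    (by simp [s₄, s₃, State.setReg, hv₂])
    (by simp [s₄, s₃, State.setReg])
    (by simp [s₄, s₃, State.setReg])
  exact ⟨s', _, .seq r₁ (.seq r₂ (.seq (.const s₂ (d + 2) 0) (.seq (.const s₃ (d + 3) 1) r'))),
    by beta_reduce; omega, hv', hr', ha'⟩

theorem mul {f g : α → ℕ} (hf : Comp f) (hg : Comp g) : Comp fun x => f x * g x :=
  iterate (F := fun x i => i * g x) hf (const 0) (snd.add hg.fst.fst) (hf.1.mul hg.1)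
    (fun _ _ hi => Nat.mul_le_mul_right _ hi) (fun _ => Nat.zero_mul _)
    (fun _ _ _ => Nat.succ_mul _ _)

theorem pow {f g : α → ℕ} (hf : Comp f) (hg : Comp g) (h : PolyBounded fun x => f x ^ g x) :
    Comp fun x => f x ^ g x := by
  refine iterate (F := fun x i => f x ^ i) hg (const 1) (snd.mul hf.fst.fst)
    -- The added 1 is for base 0, where the initial value `0 ^ 0 = 1` may exceed the final power.
    (h.add (.const 1)) (fun x i hi => ?_) (fun _ => pow_zero _) (fun _ _ _ => pow_succ _ _)
  rcases Nat.eq_zero_or_pos (f x) with h0 | h0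
  · rcases Nat.eq_zero_or_pos i with rfl | hi
    · simp
    · simp [h0, hi.ne']
  · exact (Nat.pow_le_pow_right h0 hi).trans (Nat.le_succ _)

open Classical in
theorem count {P : α × ℕ → Prop} {f : α → ℕ} (hP : CompPred P) (hf : Comp f) :
    Comp fun x => Nat.count (fun i => P (x, i)) (f x) :=
  iterate (F := fun x i => Nat.count (fun i => P (x, i)) i) hf (const 0) (snd.add hP.fst) hf.1
    (fun _ _ hi => (Nat.count_le _).trans hi) (fun _ => Nat.count_zero _)
    (fun _ _ _ => Nat.count_succ _ _)

end Comp

namespace CompPred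

theorem of_iff {P Q : α → Prop} (hP : CompPred P) (h : ∀ x, P x ↔ Q x) : CompPred Q :=
  (funext fun x => propext (h x) : P = Q) ▸ hP

theorem lt {f g : α → ℕ} (hf : Comp f) (hg : Comp g) : CompPred fun x => f x < g x :=
  (hf.ite_lt hg (.const 1) (.const 0)).of_eq fun _ => by congr

theorem not {P : α → Prop} (hP : CompPred P) : CompPred fun x => ¬ P x :=
  (Comp.sub (.const 1) hP).of_eq fun x => by by_cases h : P x <;> simp [h]

theorem and {P Q : α → Prop} (hP : CompPred P) (hQ : CompPred Q) : CompPred fun x => P x ∧ Q x :=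
  (Comp.mul hP hQ).of_eq fun x => by by_cases h : P x <;> by_cases h' : Q x <;> simp [h, h']

theorem or {P Q : α → Prop} (hP : CompPred P) (hQ : CompPred Q) : CompPred fun x => P x ∨ Q x :=
  (hP.not.and hQ.not).not.of_iff fun x => by tauto

theorem imp {P Q : α → Prop} (hP : CompPred P) (hQ : CompPred Q) : CompPred fun x => P x → Q x :=
  (hP.and hQ.not).not.of_iff fun x => by tauto

theorem le {f g : α → ℕ} (hf : Comp f) (hg : Comp g) : CompPred fun x => f x ≤ g x :=
  (lt hg hf).not.of_iff fun _ => not_lt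

theorem eq {f g : α → ℕ} (hf : Comp f) (hg : Comp g) : CompPred fun x => f x = g x :=
  ((le hf hg).and (le hg hf)).of_iff fun _ => le_antisymm_iff.symm

theorem ne {f g : α → ℕ} (hf : Comp f) (hg : Comp g) : CompPred fun x => f x ≠ g x :=
  (eq hf hg).not

/-- Bounded search amounts to counting all solutions and testing whether the count is positive. -/
theorem exists_lt {P : α × ℕ → Prop} {f : α → ℕ} (hP : CompPred P) (hf : Comp f) :
    CompPred fun x => ∃ i < f x, P (x, i) := by
  classical
  refine (lt (.const 0) (Comp.count hP hf)).of_iff fun x => ?_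
  rw [Nat.count_eq_card_filter_range, Finset.card_pos]
  simp [Finset.Nonempty]

theorem forall_lt {P : α × ℕ → Prop} {f : α → ℕ} (hP : CompPred P) (hf : Comp f) :
    CompPred fun x => ∀ i < f x, P (x, i) :=
  (exists_lt hP.not hf).not.of_iff fun x => by push Not; rfl

end CompPred

namespace Comp

open Classical in
theorem ite {P : α → Prop} {f g : α → ℕ} (hP : CompPred P) (hf : Comp f) (hg : Comp g) :
    Comp fun x => if P x then f x else g x :=
  (ite_lt (const 0) hP hf hg).of_eq fun x => by by_cases h : P x <;> simp [h]

theorem div {f g : α → ℕ} (hf : Comp f) (hg : Comp g) : Comp fun x => f x / g x := by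
  classical
  -- The quotient is the number of positive multiples of the divisor not exceeding `f`; the
  -- positivity clause yields the value 0 for division by zero.
  refine (count (P := fun y : α × ℕ => 0 < g y.1 ∧ (y.2 + 1) * g y.1 ≤ f y.1)
    ((CompPred.lt (const 0) hg.fst).and
      (CompPred.le ((snd.add (const 1)).mul hg.fst) hf.fst)) hf).of_eq fun x => ?_
  have : ((Finset.range (f x)).filter fun i => 0 < g x ∧ (i + 1) * g x ≤ f x) =
      Finset.range (f x / g x) := by
    ext i
    simp only [Finset.mem_filter, Finset.mem_range]
    rcases Nat.eq_zero_or_pos (g x) with h | h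
    · simp [h]
    · rw [← Nat.succ_le_iff (n := f x / g x), Nat.le_div_iff_mul_le h]
      refine ⟨fun h => h.2.2, fun h' => ⟨?_, h, h'⟩⟩
      have : (i + 1) * 1 ≤ (i + 1) * g x := Nat.mul_le_mul_left _ h
      simp only [Nat.succ_eq_add_one] at h'
      omega
  rw [Nat.count_eq_card_filter_range, ← Finset.card_range (f x / g x), ← this]
  congr!

theorem mod {f g : α → ℕ} (hf : Comp f) (hg : Comp g) : Comp fun x => f x % g x :=
  (hf.sub (hg.mul (hf.div hg))).of_eq fun x => by
    have := Nat.mod_add_div (f x) (g x)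
    omega

/-- The digits of a number in a given base. -/
theorem digit {f g h : α → ℕ} (hf : Comp f) (hg : Comp g) (hh : Comp h) :
    Comp fun x => f x / g x ^ h x % g x :=
  -- Dividing repeatedly avoids computing `g x ^ h x`, which need not be polynomially bounded.
  Comp.mod (iterate (F := fun x i => f x / g x ^ i) hh hf (snd.div hg.fst.fst) hf.1
    (fun _ _ _ => Nat.div_le_self _ _) (fun _ => by simp)
    (fun _ _ _ => by rw [pow_succ, Nat.div_div_eq_div_mul])) hg

end Comp

end RAM

/-! ### Greedy extension and scattered tight vertices -/

namespace SimpleGraph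

variable {V : Type*}

/-- A partial coloring, given as a relation. -/
structure IsPartialColoring (G : SimpleGraph V) {k : ℕ} (Col : V → Fin k → Prop) : Prop where
  unique : ∀ v i j, Col v i → Col v j → i = j
  proper : ∀ u v i, G.Adj u v → Col u i → ¬ Col v i

/-- Greedy choice: the sets `N h` with `h ∈ H` cover fewer points than `S` has, so some `x ∈ S`
escapes them. Moving `x` into `H` while lowering `k` by one preserves the cardinality hypothesis. -/
theorem exists_scattered [DecidableEq V] {N : V → Finset V} {d : ℕ} (hd : 0 < d) (hN : ∀ v, (N v).card ≤ d)
    (hsymm : ∀ u v, u ∈ N v → v ∈ N u) (S : Finset V) :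
    ∀ (k : ℕ) (H : Finset V), (H.card + k) * d ≤ S.card → ∃ x : Fin k → V, (∀ i, x i ∈ S) ∧
      (∀ i, ∀ h ∈ H, x i ∉ N h) ∧ ∀ i j, i ≠ j → x i ∉ N (x j)
  | 0, _, _ => ⟨finZeroElim, fun i => i.elim0, fun i => i.elim0, fun i => i.elim0⟩
  | k + 1, H, hS => by
    have hlt : (H.biUnion N).card < S.card := by
      refine (Finset.card_biUnion_le_card_mul H N d fun v _ => hN v).trans_lt
        (lt_of_lt_of_le ?_ hS)
      exact Nat.mul_lt_mul_of_pos_right (by omega) hd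
    obtain ⟨x, hxS, hxH⟩ := Finset.exists_mem_notMem_of_card_lt_card hlt
    have hcard : ((insert x H).card + k) * d ≤ S.card :=
      (Nat.mul_le_mul_right d (by have := Finset.card_insert_le x H; omega)).trans hS
    obtain ⟨y, hyS, hyH, hy⟩ := exists_scattered hd hN hsymm S k (insert x H) hcard
    refine ⟨Fin.cons x y, fun i => ?_, fun i h hh => ?_, fun i j hij => ?_⟩
    · refine Fin.cases hxS (fun i => hyS i) i
    · refine Fin.cases (fun hx => hxH (Finset.mem_biUnion.2 ⟨h, hh, hx⟩))
        (fun i => hyH i h (Finset.mem_insert_of_mem hh)) i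
    · revert hij
      refine Fin.cases ?_ (fun i => ?_) i <;> refine Fin.cases ?_ (fun j => ?_) j <;> intro hij
      · exact absurd rfl hij
      · exact fun h => hyH j x (Finset.mem_insert_self _ _) (hsymm _ _ h)
      · exact hyH i x (Finset.mem_insert_self _ _)
      · exact hy i j fun h => hij (congrArg _ h)

variable [Fintype V] [DecidableEq V] (G : SimpleGraph V) [DecidableRel G.Adj] {k : ℕ}

/-- A partial coloring with `k` colors of the vertices of degree at least `k`, and possibly some
others, extends greedily to the whole graph. -/
theorem IsPartialColoring.exists_coloring {Col : V → Fin k → Prop}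
    (hC : G.IsPartialColoring Col) (hdeg : ∀ v, k ≤ G.degree v → ∃ j, Col v j) :
    ∃ C : G.Coloring (Fin k), ∀ v j, Col v j → C v = j := by
  classical
  induction hm : (Finset.univ.filter fun v => ¬ ∃ j, Col v j).card using Nat.strong_induction_on
    generalizing Col with
  | _ m ih =>
  by_cases hall : ∀ v, ∃ j, Col v j
  · choose c hc using hall
    refine ⟨Coloring.mk c fun {u v} huv he => hC.proper u v (c u) huv (hc u) ?_, fun v j h =>
      hC.unique v _ _ (hc v) h⟩
    rw [he]
    exact hc v
  push Not at hall
  obtain ⟨v, hv⟩ := hall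
  have hlt : G.degree v < k := by
    by_contra h
    obtain ⟨j, hj⟩ := hdeg v (not_lt.1 h)
    exact hv j hj
  -- Some color is free at `v`: otherwise choosing a neighbor in each color would be injective,
  -- giving `v` at least `k` neighbors.
  obtain ⟨j, hj⟩ : ∃ j : Fin k, ∀ u, G.Adj v u → ¬ Col u j := by
    by_contra! h
    choose f hf hcol using h
    have hinj : Function.Injective f := fun i j hij =>
      hC.unique (f i) i j (hcol i) (by rw [hij]; exact hcol j)
    have := Finset.card_le_card_of_injOn (s := Finset.univ) (t := G.neighborFinset v) f
      (fun j _ => by simpa using hf j) hinj.injOn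
    rw [Finset.card_univ, Fintype.card_fin, card_neighborFinset_eq_degree] at this
    omega
  let Col' : V → Fin k → Prop := fun u i => Col u i ∨ (u = v ∧ i = j)
  have hC' : G.IsPartialColoring Col' := by
    constructor
    · rintro u a b (h | ⟨rfl, rfl⟩) (h' | ⟨h', rfl⟩)
      · exact hC.unique u a b h h'
      · exact absurd (h' ▸ h) (hv a)
      · exact absurd h' (hv b)
      · rfl
    · rintro u w a huw (h | ⟨rfl, rfl⟩) (h' | ⟨rfl, h'⟩)
      · exact hC.proper u w a huw h h'
      · exact hj u huw.symm (h' ▸ h)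
      · exact hj w huw h'
      · exact G.loopless.irrefl _ huw
  have hcard : (Finset.univ.filter fun u => ¬ ∃ i, Col' u i).card < m := by
    rw [← hm]
    refine Finset.card_lt_card ⟨fun u hu => ?_, fun h => ?_⟩
    · simp only [Finset.mem_filter, Finset.mem_univ, true_and] at hu ⊢
      exact fun ⟨i, hi⟩ => hu ⟨i, Or.inl hi⟩
    · have := h (Finset.mem_filter.2 ⟨Finset.mem_univ v, fun ⟨i, hi⟩ => hv i hi⟩)
      exact (Finset.mem_filter.1 this).2 ⟨j, Or.inr ⟨rfl, rfl⟩⟩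
  obtain ⟨C, hCC⟩ := ih _ hcard hC' (fun u hu => (hdeg u hu).imp fun _ => Or.inl)
    (by congr!)
  exact ⟨C, fun u i h => hCC u i (Or.inl h)⟩

/-- The closed neighborhood. -/
def closedNbhd (v : V) : Finset V := insert v (G.neighborFinset v)

theorem mem_closedNbhd {u v : V} : u ∈ G.closedNbhd v ↔ u = v ∨ G.Adj v u := by
  simp [closedNbhd]

theorem mem_closedNbhd_comm {u v : V} : u ∈ G.closedNbhd v ↔ v ∈ G.closedNbhd u := by
  rw [mem_closedNbhd, mem_closedNbhd, eq_comm, G.adj_comm]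

theorem card_closedNbhd (v : V) : (G.closedNbhd v).card = G.degree v + 1 := by
  rw [closedNbhd, Finset.card_insert_of_notMem (by simp), card_neighborFinset_eq_degree]

/-- The ball of radius three. -/
def ballThree (v : V) : Finset V :=
  ((G.closedNbhd v).biUnion G.closedNbhd).biUnion G.closedNbhd

theorem mem_ballThree {u v : V} : u ∈ G.ballThree v ↔
    ∃ a b, a ∈ G.closedNbhd v ∧ b ∈ G.closedNbhd a ∧ u ∈ G.closedNbhd b := by
  simp only [ballThree, Finset.mem_biUnion]
  constructor
  · rintro ⟨b, ⟨a, ha, hb⟩, hu⟩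
    exact ⟨a, b, ha, hb, hu⟩
  · rintro ⟨a, b, ha, hb, hu⟩
    exact ⟨b, ⟨a, ha, hb⟩, hu⟩

theorem mem_ballThree_comm {u v : V} : u ∈ G.ballThree v ↔ v ∈ G.ballThree u := by
  rw [mem_ballThree, mem_ballThree]
  constructor <;> rintro ⟨a, b, h₁, h₂, h₃⟩ <;>
    exact ⟨b, a, G.mem_closedNbhd_comm.1 h₃, G.mem_closedNbhd_comm.1 h₂,
      G.mem_closedNbhd_comm.1 h₁⟩

theorem card_ballThree_le (v : V) : (G.ballThree v).card ≤
    (G.maxDegree + 1) * (G.maxDegree + 1) * (G.maxDegree + 1) := by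
  have h : ∀ u, (G.closedNbhd u).card ≤ G.maxDegree + 1 := fun u => by
    rw [card_closedNbhd]
    exact Nat.succ_le_succ (G.degree_le_maxDegree u)
  refine Finset.card_biUnion_le_card_mul _ _ _ (fun _ _ => h _) |>.trans
    (Nat.mul_le_mul_right _ ?_)
  exact Finset.card_biUnion_le_card_mul _ _ _ (fun _ _ => h _) |>.trans
    (Nat.mul_le_mul_right _ (h v))

/-- The closed neighborhood has exactly `k` elements, so it is in bijection with the colors; a
transposition then moves the color of `v` to `i`. -/
theorem exists_rainbow_closedNbhd {v : V} (hv : G.degree v + 1 = k) (i : Fin k) :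
    ∃ e : V → Fin k, Set.InjOn e (G.closedNbhd v) ∧ e v = i ∧
      ∀ j, ∃ u ∈ G.closedNbhd v, e u = j := by
  have hcard : Fintype.card (G.closedNbhd v) = Fintype.card (Fin k) := by
    rw [Fintype.card_coe, card_closedNbhd, hv, Fintype.card_fin]
  have hvv : v ∈ G.closedNbhd v := G.mem_closedNbhd.2 (Or.inl rfl)
  let e₀ := Fintype.equivOfCardEq hcard
  let e₁ := e₀.trans (Equiv.swap (e₀ ⟨v, hvv⟩) i)
  refine ⟨fun u => if h : u ∈ G.closedNbhd v then e₁ ⟨u, h⟩ else i, fun u hu w hw huw => ?_, ?_,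
    fun j => ⟨(e₁.symm j).1, (e₁.symm j).2, by simp⟩⟩
  · rw [Finset.mem_coe] at hu hw
    simp only [hu, hw, dif_pos] at huw
    exact congrArg Subtype.val (e₁.injective huw)
  · simp [hvv, e₁]

/-- If there are many vertices of degree `k - 1`, then a graph with a proper coloring with `k`
colors has a `b`-coloring with `b`-vertices among them. -/
theorem exists_bColoring_of_card_le (C : G.Coloring (Fin k)) (S : Finset V)
    (hS : ∀ v ∈ S, G.degree v + 1 = k)
    (hcard : ((Finset.univ.filter fun v => k ≤ G.degree v).card + k) *
      ((G.maxDegree + 1) * (G.maxDegree + 1) * (G.maxDegree + 1)) ≤ S.card) :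
    ∃ C' : G.Coloring (Fin k), ∀ i, ∃ x ∈ S, C' x = i ∧ ∀ j, j ≠ i → ∃ y, G.Adj x y ∧ C' y = j := by
  obtain ⟨x, hxS, hxH, hx⟩ := exists_scattered (by positivity) G.card_ballThree_le
    (fun _ _ h => G.mem_ballThree_comm.1 h) S k _ hcard
  choose e hinj hei hsurj using fun i => G.exists_rainbow_closedNbhd (hS (x i) (hxS i)) i
  have hself : ∀ v, v ∈ G.closedNbhd v := fun v => G.mem_closedNbhd.2 (Or.inl rfl)
  -- No high vertex lies in or next to a chosen closed neighborhood, since it would be within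
  -- distance two of `x i`.
  have hHx : ∀ i u v, k ≤ G.degree u → v ∈ G.closedNbhd (x i) → v ∉ G.closedNbhd u := by
    intro i u v hu hv h
    refine hxH i u (by simpa using hu) (G.mem_ballThree.2 ⟨v, v, h, hself v, ?_⟩)
    exact G.mem_closedNbhd_comm.1 hv
  -- Distinct chosen closed neighborhoods are disjoint and have no edge between them: either would
  -- put the centers within distance three.
  have hxx : ∀ i j u v, u ∈ G.closedNbhd (x i) → v ∈ G.closedNbhd (x j) →
      v ∈ G.closedNbhd u → i = j := by
    intro i j u v hu hv huv
    by_contra hij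
    exact hx j i (Ne.symm hij) (G.mem_ballThree.2 ⟨u, v, hu, huv, G.mem_closedNbhd_comm.1 hv⟩)
  let Col : V → Fin k → Prop := fun v j =>
    (k ≤ G.degree v ∧ C v = j) ∨ ∃ i, v ∈ G.closedNbhd (x i) ∧ e i v = j
  have hCol : G.IsPartialColoring Col := by
    constructor
    · rintro v a b (⟨h, rfl⟩ | ⟨i, h, rfl⟩) (⟨h', rfl⟩ | ⟨j, h', rfl⟩)
      · rfl
      · exact absurd (hself v) (hHx j v v h h')
      · exact absurd (hself v) (hHx i v v h' h)
      · rw [hxx i j v v h h' (hself v)]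
    · rintro u v a huv (⟨h, rfl⟩ | ⟨i, h, rfl⟩) (⟨h', h''⟩ | ⟨j, h', h''⟩)
      · exact C.valid huv h''.symm
      · exact hHx j u v h h' (G.mem_closedNbhd.2 (Or.inr huv))
      · exact hHx i v u h' h (G.mem_closedNbhd.2 (Or.inr huv.symm))
      · obtain rfl := hxx i j u v h h' (G.mem_closedNbhd.2 (Or.inr huv))
        exact G.ne_of_adj huv (hinj i h h' h''.symm)
  obtain ⟨C', hC'⟩ := hCol.exists_coloring G fun v hv => ⟨C v, Or.inl ⟨hv, rfl⟩⟩
  refine ⟨C', fun i => ⟨x i, hxS i, hC' _ _ (Or.inr ⟨i, hself _, hei i⟩), fun j hji => ?_⟩⟩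
  obtain ⟨y, hy, rfl⟩ := hsurj i j
  refine ⟨y, (G.mem_closedNbhd.1 hy).resolve_left fun h => hji ?_, hC' _ _ (Or.inr ⟨i, hy, rfl⟩)⟩
  rw [h, hei]

end SimpleGraph

namespace BInstance

/-! ## The algorithm, as a predicate on instances -/

/-- Adjacency. -/
def Adj (I : BInstance) (u v : ℕ) : Prop :=
  ∃ (hu : u < I.n) (hv : v < I.n), I.G.Adj ⟨u, hu⟩ ⟨v, hv⟩

open Classical in
/-- The degree of a vertex. -/
noncomputable def deg (I : BInstance) (v : ℕ) : ℕ := Nat.count (I.Adj v) I.n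

/-- Some degree exceeds `d`. -/
def DegExceeds (I : BInstance) (d : ℕ) : Prop := ∃ v < I.n, d < I.deg v

open Classical in
/-- The maximum degree. -/
noncomputable def delta (I : BInstance) : ℕ := Nat.count I.DegExceeds I.n

/-- The vertices of degree at least `k`. -/
def High (I : BInstance) (v : ℕ) : Prop := I.k ≤ I.deg v

/-- The vertices of degree `k - 1`. -/
def Tight (I : BInstance) (v : ℕ) : Prop := I.deg v + 1 = I.k

open Classical in
/-- The number of vertices of degree at least `k`. -/
noncomputable def ell (I : BInstance) : ℕ := Nat.count I.High I.n

/-- A number of vertices of degree `k - 1` that suffices to have `k` scattered ones. -/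
noncomputable def threshold (I : BInstance) : ℕ :=
  (I.ell + I.k) * ((I.delta + 1) * (I.delta + 1) * (I.delta + 1))

open Classical in
/-- The candidates for `b`-vertices: the vertices of degree at least `k`, and the first few of the
vertices of degree `k - 1`. -/
def Cand (I : BInstance) (v : ℕ) : Prop :=
  I.High v ∨ (I.Tight v ∧ Nat.count I.Tight v < I.threshold)

open Classical in
/-- The number of candidates. -/
noncomputable def width (I : BInstance) : ℕ := Nat.count I.Cand I.n

open Classical in
/-- `v` is the candidate chosen by the code `b` as `b`-vertex of color `i`. -/
def IsChosen (I : BInstance) (b v i : ℕ) : Prop :=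
  I.Cand v ∧ Nat.count I.Cand v = b / I.width ^ i % I.width

open Classical in
/-- `v` is the neighbor of color `j` chosen by the code `c` for the vertex `x` of color `i`. -/
def IsWitness (I : BInstance) (c x v i j : ℕ) : Prop :=
  I.Adj x v ∧
    Nat.count (I.Adj x) v = c / (I.delta + 1) ^ (i * I.k + j) % (I.delta + 1)

open Classical in
/-- The partial coloring encoded by `a` (the colors of the vertices of high degree), `b` (the
`b`-vertices) and `c` (their neighbors). -/
def Col (I : BInstance) (a b c v j : ℕ) : Prop :=
  (I.High v ∧ a / I.k ^ Nat.count I.High v % I.k = j) ∨ I.IsChosen b v j ∨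
    ∃ i < I.k, i ≠ j ∧ ∃ x < I.n, I.IsChosen b x i ∧ I.IsWitness c x v i j

/-- The partial coloring encoded by `a`, `b`, `c` is proper, colors all vertices of high degree,
and is a `b`-coloring. -/
def Good (I : BInstance) (a b c : ℕ) : Prop :=
  (∀ u < I.n, ∀ v < I.n, ∀ i < I.k, ∀ j < I.k, I.Col a b c u i → I.Col a b c v j →
    (u = v → i = j) ∧ (I.Adj u v → i ≠ j)) ∧
  (∀ i < I.k, ∃ x < I.n, I.Col a b c x i ∧
    ∀ j < I.k, j ≠ i → ∃ y < I.n, I.Adj x y ∧ I.Col a b c y j) ∧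
  ∀ v < I.n, I.High v → ∃ j < I.k, I.Col a b c v j

/-- The number of colors, if it is at most `Δ + 1`. -/
noncomputable def kappa (I : BInstance) : ℕ := if I.k ≤ I.delta + 1 then I.k else 0

/-- Some codes encode a suitable partial coloring. -/
def Accept (I : BInstance) : Prop :=
  I.k ≤ I.delta + 1 ∧ ∃ a < I.kappa ^ I.ell, ∃ b < I.width ^ I.kappa,
    ∃ c < (I.delta + 1) ^ (I.kappa * I.kappa), I.Good a b c

end BInstance

/-! ### Polynomial-time evaluation of the acceptance predicate -/

namespace RAM

open Context

/-- A context containing an instance of `b`-Coloring with `k ≤ n`. -/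
class InstanceContext (α : Type) extends Context α where
  /-- the instance -/
  inst : α → BInstance
  comp_n : Comp fun x => (inst x).n
  comp_k : Comp fun x => (inst x).k
  cells_eq : ∀ x, cells x = (inst x).input.arr 0

open InstanceContext

instance InstanceContext.prod {α : Type} [InstanceContext α] : InstanceContext (α × ℕ) where
  toContext := Context.prod
  inst x := inst x.1
  comp_n := comp_n.fst
  comp_k := comp_k.fst
  cells_eq x := cells_eq x.1

variable {α : Type} [InstanceContext α]

theorem comp_n : Comp fun x : α => (inst x).n := InstanceContext.comp_n

theorem comp_k : Comp fun x : α => (inst x).k := InstanceContext.comp_k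

/-- Row and column are recovered from the cell index as quotient and remainder modulo `n`. -/
theorem input_arr_eq (I : BInstance) {u v : ℕ} (hu : u < I.n) (hv : v < I.n) :
    0 < I.input.arr 0 (u * I.n + v) ↔ I.Adj u v := by
  have : (∃ i j : Fin I.n, I.G.Adj i j ∧ u * I.n + v = i * I.n + j) ↔ I.Adj u v := by
    constructor
    · rintro ⟨i, j, hij, h⟩
      have h₁ := congrArg (· % I.n) h
      have h₂ := congrArg (· / I.n) h
      have hn : 0 < I.n := by omega
      simp only [Nat.mul_add_mod_self_right, Nat.mod_eq_of_lt hv, Nat.mod_eq_of_lt j.2] at h₁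
      simp only [Nat.mul_comm _ I.n, Nat.mul_add_div hn, Nat.div_eq_of_lt hv,
        Nat.div_eq_of_lt j.2, add_zero] at h₂
      exact ⟨hu, hv, by convert hij⟩
    · rintro ⟨hu, hv, h⟩
      exact ⟨⟨u, hu⟩, ⟨v, hv⟩, h, rfl⟩
  rw [← this]
  simp only [BInstance.input, true_and]
  split_ifs with h <;> simpa using h

theorem comp_adj {u v : α → ℕ} (hu : Comp u) (hv : Comp v) :
    CompPred fun x => (inst x).Adj (u x) (v x) := by
  have hload : Comp fun x => cells x (u x * (inst x).n + v x) :=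
    .load ((hu.mul comp_n).add hv) <| (PolyBounded.const 1).mono fun x => by
      rw [cells_eq]
      simp only [BInstance.input]
      split_ifs <;> omega
  -- The range tests are needed because an index `u * n + v` with `v ≥ n` may address a cell of
  -- another row.
  refine ((CompPred.lt hu comp_n).and ((CompPred.lt hv comp_n).and
    (CompPred.lt (.const 0) hload))).of_iff fun x => ?_
  rw [cells_eq]
  constructor
  · rintro ⟨h₁, h₂, h₃⟩
    exact (input_arr_eq _ h₁ h₂).1 h₃
  · rintro ⟨h₁, h₂, h₃⟩
    exact ⟨h₁, h₂, (input_arr_eq _ h₁ h₂).2 ⟨h₁, h₂, h₃⟩⟩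

theorem comp_deg {v : α → ℕ} (hv : Comp v) : Comp fun x => (inst x).deg (v x) :=
  Comp.count (P := fun y : α × ℕ => (inst y.1).Adj (v y.1) y.2) (comp_adj hv.fst Comp.snd) comp_n

theorem comp_delta : Comp fun x : α => (inst x).delta :=
  have h : CompPred fun y : α × ℕ => (inst y.1).DegExceeds y.2 :=
    CompPred.exists_lt (P := fun z : (α × ℕ) × ℕ => z.1.2 < (inst z.1.1).deg z.2)
      (CompPred.lt Comp.snd.fst (comp_deg Comp.snd)) comp_n
  Comp.count h comp_n

theorem comp_high {v : α → ℕ} (hv : Comp v) : CompPred fun x => (inst x).High (v x) :=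
  CompPred.le comp_k (comp_deg hv)

theorem comp_tight {v : α → ℕ} (hv : Comp v) : CompPred fun x => (inst x).Tight (v x) :=
  CompPred.eq ((comp_deg hv).add (.const 1)) comp_k

open Classical in
theorem comp_count_high {v : α → ℕ} (hv : Comp v) :
    Comp fun x => Nat.count (inst x).High (v x) :=
  Comp.count (P := fun y : α × ℕ => (inst y.1).High y.2) (comp_high (α := α × ℕ) Comp.snd) hv

theorem comp_ell : Comp fun x : α => (inst x).ell := comp_count_high comp_n

theorem comp_threshold : Comp fun x : α => (inst x).threshold :=
  have h := comp_delta (α := α).add (.const 1)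
  (comp_ell.add comp_k).mul ((h.mul h).mul h)

theorem comp_cand {v : α → ℕ} (hv : Comp v) : CompPred fun x => (inst x).Cand (v x) :=
  (comp_high hv).or ((comp_tight hv).and (CompPred.lt
    (Comp.count (P := fun y : α × ℕ => (inst y.1).Tight y.2) (comp_tight (α := α × ℕ) Comp.snd) hv)
    comp_threshold))

open Classical in
theorem comp_count_cand {v : α → ℕ} (hv : Comp v) :
    Comp fun x => Nat.count (inst x).Cand (v x) :=
  Comp.count (P := fun y : α × ℕ => (inst y.1).Cand y.2) (comp_cand (α := α × ℕ) Comp.snd) hv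

theorem comp_width : Comp fun x : α => (inst x).width := comp_count_cand comp_n

theorem comp_isChosen {b v i : α → ℕ} (hb : Comp b) (hv : Comp v) (hi : Comp i) :
    CompPred fun x => (inst x).IsChosen (b x) (v x) (i x) :=
  (comp_cand hv).and (CompPred.eq (comp_count_cand hv) (hb.digit comp_width hi))

theorem comp_isWitness {c x v i j : α → ℕ} (hc : Comp c) (hx : Comp x) (hv : Comp v)
    (hi : Comp i) (hj : Comp j) :
    CompPred fun y => (inst y).IsWitness (c y) (x y) (v y) (i y) (j y) :=
  (comp_adj hx hv).and (CompPred.eq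
    (Comp.count (P := fun y : α × ℕ => (inst y.1).Adj (x y.1) y.2) (comp_adj hx.fst Comp.snd) hv)
    (hc.digit (comp_delta.add (.const 1)) ((hi.mul comp_k).add hj)))

theorem comp_col {a b c v j : α → ℕ} (ha : Comp a) (hb : Comp b) (hc : Comp c) (hv : Comp v)
    (hj : Comp j) : CompPred fun x => (inst x).Col (a x) (b x) (c x) (v x) (j x) := by
  have h : CompPred fun z : (α × ℕ) × ℕ => (inst z.1.1).IsChosen (b z.1.1) z.2 z.1.2 ∧
      (inst z.1.1).IsWitness (c z.1.1) z.2 (v z.1.1) z.1.2 (j z.1.1) :=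
    (comp_isChosen hb.fst.fst Comp.snd Comp.snd.fst).and
      (comp_isWitness hc.fst.fst Comp.snd hv.fst.fst Comp.snd.fst hj.fst.fst)
  have h' : CompPred fun y : α × ℕ => y.2 ≠ j y.1 ∧ ∃ x < (inst y.1).n,
      (inst y.1).IsChosen (b y.1) x y.2 ∧ (inst y.1).IsWitness (c y.1) x (v y.1) y.2 (j y.1) :=
    (CompPred.ne Comp.snd hj.fst).and (CompPred.exists_lt h comp_n)
  exact ((comp_high hv).and (CompPred.eq (ha.digit comp_k (comp_count_high hv)) hj)).or
    ((comp_isChosen hb hv hj).or (CompPred.exists_lt h' comp_k))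

theorem comp_good {a b c : α → ℕ} (ha : Comp a) (hb : Comp b) (hc : Comp c) :
    CompPred fun x => (inst x).Good (a x) (b x) (c x) := by
  refine CompPred.and ?_ (CompPred.and ?_ ?_)
  · refine CompPred.forall_lt (P := fun x : α × ℕ => ∀ v < (inst x.1).n, ∀ i < (inst x.1).k,
      ∀ j < (inst x.1).k, (inst x.1).Col (a x.1) (b x.1) (c x.1) x.2 i →
        (inst x.1).Col (a x.1) (b x.1) (c x.1) v j →
        (x.2 = v → i = j) ∧ ((inst x.1).Adj x.2 v → i ≠ j)) ?_ comp_n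
    refine CompPred.forall_lt (P := fun x : (α × ℕ) × ℕ => ∀ i < (inst x.1.1).k,
      ∀ j < (inst x.1.1).k, (inst x.1.1).Col (a x.1.1) (b x.1.1) (c x.1.1) x.1.2 i →
        (inst x.1.1).Col (a x.1.1) (b x.1.1) (c x.1.1) x.2 j →
        (x.1.2 = x.2 → i = j) ∧ ((inst x.1.1).Adj x.1.2 x.2 → i ≠ j)) ?_ comp_n
    refine CompPred.forall_lt (P := fun x : ((α × ℕ) × ℕ) × ℕ => ∀ j < (inst x.1.1.1).k,
      (inst x.1.1.1).Col (a x.1.1.1) (b x.1.1.1) (c x.1.1.1) x.1.1.2 x.2 →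
        (inst x.1.1.1).Col (a x.1.1.1) (b x.1.1.1) (c x.1.1.1) x.1.2 j →
        (x.1.1.2 = x.1.2 → x.2 = j) ∧ ((inst x.1.1.1).Adj x.1.1.2 x.1.2 → x.2 ≠ j)) ?_ comp_k
    refine CompPred.forall_lt (P := fun x : (((α × ℕ) × ℕ) × ℕ) × ℕ =>
      (inst x.1.1.1.1).Col (a x.1.1.1.1) (b x.1.1.1.1) (c x.1.1.1.1) x.1.1.1.2 x.1.2 →
        (inst x.1.1.1.1).Col (a x.1.1.1.1) (b x.1.1.1.1) (c x.1.1.1.1) x.1.1.2 x.2 →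
        (x.1.1.1.2 = x.1.1.2 → x.1.2 = x.2) ∧
          ((inst x.1.1.1.1).Adj x.1.1.1.2 x.1.1.2 → x.1.2 ≠ x.2)) ?_ comp_k
    have ha' := ha.fst.fst.fst.fst
    have hb' := hb.fst.fst.fst.fst
    have hc' := hc.fst.fst.fst.fst
    have hu := (Comp.snd (α := α)).fst.fst.fst
    have hv := (Comp.snd (α := α × ℕ)).fst.fst
    have hi := (Comp.snd (α := (α × ℕ) × ℕ)).fst
    exact (comp_col ha' hb' hc' hu hi).imp ((comp_col ha' hb' hc' hv Comp.snd).imp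
      (((CompPred.eq hu hv).imp (CompPred.eq hi Comp.snd)).and
        ((comp_adj hu hv).imp (CompPred.ne hi Comp.snd))))
  · refine CompPred.forall_lt (P := fun x : α × ℕ => ∃ v < (inst x.1).n,
      (inst x.1).Col (a x.1) (b x.1) (c x.1) v x.2 ∧ ∀ j < (inst x.1).k, j ≠ x.2 →
        ∃ y < (inst x.1).n, (inst x.1).Adj v y ∧
          (inst x.1).Col (a x.1) (b x.1) (c x.1) y j) ?_ comp_k
    refine CompPred.exists_lt (P := fun x : (α × ℕ) × ℕ =>
      (inst x.1.1).Col (a x.1.1) (b x.1.1) (c x.1.1) x.2 x.1.2 ∧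
        ∀ j < (inst x.1.1).k, j ≠ x.1.2 → ∃ y < (inst x.1.1).n, (inst x.1.1).Adj x.2 y ∧
          (inst x.1.1).Col (a x.1.1) (b x.1.1) (c x.1.1) y j) ?_ comp_n
    refine (comp_col ha.fst.fst hb.fst.fst hc.fst.fst Comp.snd Comp.snd.fst).and ?_
    refine CompPred.forall_lt (P := fun x : ((α × ℕ) × ℕ) × ℕ => x.2 ≠ x.1.1.2 →
      ∃ y < (inst x.1.1.1).n, (inst x.1.1.1).Adj x.1.2 y ∧
          (inst x.1.1.1).Col (a x.1.1.1) (b x.1.1.1) (c x.1.1.1) y x.2) ?_ comp_k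
    refine (CompPred.ne Comp.snd Comp.snd.fst.fst).imp ?_
    refine CompPred.exists_lt (P := fun x : (((α × ℕ) × ℕ) × ℕ) × ℕ =>
      (inst x.1.1.1.1).Adj x.1.1.2 x.2 ∧
        (inst x.1.1.1.1).Col (a x.1.1.1.1) (b x.1.1.1.1) (c x.1.1.1.1) x.2 x.1.2) ?_ comp_n
    exact (comp_adj Comp.snd.fst.fst Comp.snd).and
      (comp_col ha.fst.fst.fst.fst hb.fst.fst.fst.fst hc.fst.fst.fst.fst Comp.snd Comp.snd.fst)
  · refine CompPred.forall_lt (P := fun x : α × ℕ => (inst x.1).High x.2 →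
      ∃ j < (inst x.1).k, (inst x.1).Col (a x.1) (b x.1) (c x.1) x.2 j) ?_ comp_n
    refine (comp_high (α := α × ℕ) Comp.snd).imp ?_
    exact CompPred.exists_lt (P := fun x : (α × ℕ) × ℕ =>
      (inst x.1.1).Col (a x.1.1) (b x.1.1) (c x.1.1) x.1.2 x.2)
      (comp_col ha.fst.fst hb.fst.fst hc.fst.fst Comp.snd.fst Comp.snd) comp_k

theorem comp_kappa : Comp fun x : α => (inst x).kappa :=
  (Comp.ite (CompPred.le comp_k (comp_delta.add (.const 1))) comp_k (.const 0)) |>.of_eq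
    fun x => by unfold BInstance.kappa; congr

/-- The hypotheses isolate the non-polynomial part of the cost, the three search ranges. The search
is run even if `k > Δ + 1`, and `kappa = 0` then keeps the ranges small. -/
theorem comp_accept (ha : PolyBounded fun x : α => (inst x).kappa ^ (inst x).ell)
    (hb : PolyBounded fun x : α => (inst x).width ^ (inst x).kappa)
    (hc : PolyBounded fun x : α =>
      ((inst x).delta + 1) ^ ((inst x).kappa * (inst x).kappa)) :
    CompPred fun x : α => (inst x).Accept := by
  have ha' := Comp.pow comp_kappa comp_ell ha
  have hb' := Comp.pow comp_width comp_kappa hb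
  have hc' := Comp.pow (comp_delta.add (.const 1)) (comp_kappa.mul comp_kappa) hc
  refine (CompPred.le comp_k (comp_delta.add (.const 1))).and ?_
  refine CompPred.exists_lt (P := fun x : α × ℕ => ∃ b < (inst x.1).width ^ (inst x.1).kappa,
    ∃ c < ((inst x.1).delta + 1) ^ ((inst x.1).kappa * (inst x.1).kappa),
      (inst x.1).Good x.2 b c) ?_ ha'
  refine CompPred.exists_lt (P := fun x : (α × ℕ) × ℕ =>
    ∃ c < ((inst x.1.1).delta + 1) ^ ((inst x.1.1).kappa * (inst x.1.1).kappa),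
      (inst x.1.1).Good x.1.2 x.2 c) ?_ hb'.fst
  exact CompPred.exists_lt (P := fun x : ((α × ℕ) × ℕ) × ℕ =>
      (inst x.1.1.1).Good x.1.1.2 x.1.2 x.2)
    (comp_good Comp.snd.fst.fst Comp.snd.fst Comp.snd) hc'.fst.fst

end RAM

/-! ## Correctness of the algorithm -/

theorem Nat.exists_count_eq (p : ℕ → Prop) [DecidablePred p] :
    ∀ {n t : ℕ}, t < Nat.count p n → ∃ v < n, p v ∧ Nat.count p v = t
  | 0, _, h => by simp at h
  | n + 1, t, h => by
    by_cases ht : t < Nat.count p n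
    · obtain ⟨v, hv, h'⟩ := Nat.exists_count_eq p ht
      exact ⟨v, hv.trans (Nat.lt_succ_self n), h'⟩
    · rw [Nat.count_succ] at h
      split_ifs at h with hp
      · exact ⟨n, Nat.lt_succ_self n, hp, by omega⟩
      · exact absurd h ht

theorem Nat.count_eq_card_fin (p : ℕ → Prop) [DecidablePred p] (n : ℕ) :
    Nat.count p n = (Finset.univ.filter fun v : Fin n => p v).card := by
  rw [Nat.count_eq_card_filter_range, ← Finset.card_map Fin.valEmbedding]
  congr 1
  ext v
  simp only [Finset.mem_filter, Finset.mem_range, Finset.mem_map, Finset.mem_univ, true_and,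
    Fin.valEmbedding_apply]
  exact ⟨fun ⟨h, hp⟩ => ⟨⟨v, h⟩, hp, rfl⟩, fun ⟨u, hu, h⟩ => h ▸ ⟨u.2, hu⟩⟩

/-- Every sequence of digits is the sequence of digits of a number. -/
theorem Nat.exists_digits (R M : ℕ) (g : ℕ → ℕ) (hg : ∀ i < M, g i < R) :
    ∃ c < R ^ M, ∀ i < M, c / R ^ i % R = g i := by
  let c := finFunctionFinEquiv fun i : Fin M => (⟨g i, hg i i.2⟩ : Fin R)
  refine ⟨c, c.2, fun i hi => ?_⟩
  rw [← finFunctionFinEquiv_symm_apply_val c ⟨i, hi⟩, Equiv.symm_apply_apply]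

/-- The value at `v` is stored in the digit indexed by the rank of `v` among the elements satisfying
`p`, so a function on a sparse set costs only as many digits as the set has elements. -/
theorem Nat.exists_digits_count (p : ℕ → Prop) [DecidablePred p] (R n : ℕ) (f : ℕ → ℕ)
    (hf : ∀ v < n, f v < R) :
    ∃ c < R ^ Nat.count p n, ∀ v < n, p v → c / R ^ Nat.count p v % R = f v := by
  choose! w hwn hwp hw using fun t (ht : t < Nat.count p n) => Nat.exists_count_eq p ht
  obtain ⟨c, hc, h⟩ := Nat.exists_digits R (Nat.count p n) (fun t => f (w t))
    fun t ht => hf _ (hwn t ht)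
  refine ⟨c, hc, fun v hv hpv => ?_⟩
  have hlt : Nat.count p v < Nat.count p n := Nat.count_strict_mono hpv hv
  rw [h _ hlt, Nat.count_injective (hwp _ hlt) hpv (hw _ hlt)]

namespace BInstance

variable (I : BInstance)

theorem adj_iff (u v : Fin I.n) : I.Adj u v ↔ I.G.Adj u v :=
  ⟨fun ⟨_, _, h⟩ => h, fun h => ⟨u.2, v.2, h⟩⟩

open Classical in
theorem deg_eq (v : Fin I.n) : I.deg v = I.G.degree v := by
  rw [deg, Nat.count_eq_card_fin, ← SimpleGraph.card_neighborFinset_eq_degree]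
  congr 1
  ext u
  simp [adj_iff]

/-- The values exceeded by some degree are exactly those below the maximum degree, and as this is at
most `n`, counting below `n` misses none. -/
theorem delta_eq : I.delta = maxDeg I.G := by
  classical
  have h : ∀ d, I.DegExceeds d ↔ d < maxDeg I.G := by
    intro d
    constructor
    · rintro ⟨v, hv, hd⟩
      refine lt_of_lt_of_le ?_ (I.G.degree_le_maxDegree ⟨v, hv⟩)
      rwa [← deg_eq]
    · intro hd
      rcases Nat.eq_zero_or_pos I.n with hn | hn
      · have : IsEmpty (Fin I.n) := by rw [hn]; infer_instance
        simp [maxDeg] at hd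
      · have : Nonempty (Fin I.n) := ⟨⟨0, hn⟩⟩
        obtain ⟨v, hv⟩ := I.G.exists_maximal_degree_vertex
        refine ⟨v, v.2, ?_⟩
        rw [deg_eq, ← hv]
        exact hd
  have hle : maxDeg I.G ≤ I.n := by
    refine SimpleGraph.maxDegree_le_of_forall_degree_le _ _ fun v => ?_
    rw [← deg_eq]
    exact Nat.count_le _
  rw [delta, Nat.count_eq_card_filter_range]
  have : (Finset.range I.n).filter I.DegExceeds = Finset.range (maxDeg I.G) := by
    ext d
    simp only [Finset.mem_filter, Finset.mem_range, h]
    omega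
  rw [← Finset.card_range (maxDeg I.G), ← this]

theorem ell_eq : I.ell = numHighDeg I.G I.k := by
  classical
  rw [ell, Nat.count_eq_card_fin, numHighDeg]
  congr 1
  ext v
  simp [High, deg_eq]

theorem deg_le_delta (v : Fin I.n) : I.deg v ≤ I.delta := by
  classical
  rw [delta_eq, deg_eq]
  exact I.G.degree_le_maxDegree v

/-- Soundness: the encoded relation is a partial coloring covering the high vertices, and its greedy
extension retains the `b`-vertices and their witnesses. -/
theorem Good.hasBColoring {I : BInstance} {a b c : ℕ} (h : I.Good a b c) :
    HasBColoring I.G I.k := by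
  classical
  obtain ⟨hcol, hb, hhigh⟩ := h
  have hC : I.G.IsPartialColoring fun (v : Fin I.n) (j : Fin I.k) => I.Col a b c v j := by
    constructor
    · intro v i j hi hj
      exact Fin.ext ((hcol v v.2 v v.2 i i.2 j j.2 hi hj).1 rfl)
    · intro u v i huv hu hv
      exact (hcol u u.2 v v.2 i i.2 i i.2 hu hv).2 ((I.adj_iff u v).2 huv) rfl
  obtain ⟨C, hCC⟩ := hC.exists_coloring I.G fun v hv => by
    obtain ⟨j, hj, h⟩ := hhigh v v.2 (by rwa [High, deg_eq])
    exact ⟨⟨j, hj⟩, h⟩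
  refine ⟨C, fun i => ?_⟩
  obtain ⟨x, hx, hxi, hxy⟩ := hb i i.2
  refine ⟨⟨x, hx⟩, hCC _ _ hxi, fun j hji => ?_⟩
  obtain ⟨y, hy, hadj, hyj⟩ := hxy j j.2 fun h => hji (Fin.ext h)
  exact ⟨⟨y, hy⟩, (I.adj_iff ⟨x, hx⟩ ⟨y, hy⟩).1 hadj, hCC _ _ hyj⟩

theorem le_deg_of_bVertex {C : I.G.Coloring (Fin I.k)} {i : Fin I.k} {x : Fin I.n}
    (hx : ∀ j, j ≠ i → ∃ y, I.G.Adj x y ∧ C y = j) : I.k ≤ I.deg x + 1 := by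
  classical
  have : Nonempty (Fin I.n) := ⟨x⟩
  choose! y hy using hx
  have := Finset.card_le_card_of_injOn (s := Finset.univ.erase i) (t := I.G.neighborFinset x) y
    (fun j hj => by simpa using (hy j (Finset.ne_of_mem_erase hj)).1)
    (fun j hj j' hj' h => by
      rw [← (hy j (Finset.ne_of_mem_erase hj)).2, h, (hy j' (Finset.ne_of_mem_erase hj')).2])
  rw [Finset.card_erase_of_mem (Finset.mem_univ i), Finset.card_univ, Fintype.card_fin,
    SimpleGraph.card_neighborFinset_eq_degree] at this
  rw [deg_eq]
  omega

/-- If the truncation discards no tight vertex, the given coloring already works. Otherwise the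
retained tight vertices reach the threshold and `exists_bColoring_of_card_le` recolors. -/
theorem exists_bColoring_cand (h : HasBColoring I.G I.k) :
    ∃ C : I.G.Coloring (Fin I.k), ∀ i, ∃ x : Fin I.n, I.Cand x ∧ C x = i ∧
      ∀ j, j ≠ i → ∃ y, I.G.Adj x y ∧ C y = j := by
  classical
  obtain ⟨C, hC⟩ := h
  by_cases hT : ∀ v < I.n, I.Tight v → Nat.count I.Tight v < I.threshold
  · refine ⟨C, fun i => ?_⟩
    obtain ⟨x, hxi, hx⟩ := hC i
    refine ⟨x, ?_, hxi, hx⟩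
    rcases Nat.lt_or_ge (I.deg x) I.k with hlt | hge
    · have ht : I.Tight x := le_antisymm hlt (I.le_deg_of_bVertex hx)
      exact Or.inr ⟨ht, hT x x.2 ht⟩
    · exact Or.inl hge
  push Not at hT
  obtain ⟨v₀, hv₀, -, hv₀T⟩ := hT
  let S : Finset (Fin I.n) :=
    Finset.univ.filter fun v => I.Tight v ∧ Nat.count I.Tight v < I.threshold
  have hS : I.threshold ≤ S.card := by
    have : ∀ t : Fin I.threshold, ∃ v : Fin I.n, I.Tight v ∧ Nat.count I.Tight v = t := by
      intro t
      obtain ⟨v, hv, h⟩ := Nat.exists_count_eq I.Tight (t.2.trans_le hv₀T)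
      exact ⟨⟨v, hv.trans hv₀⟩, h⟩
    choose f hf using this
    have := Finset.card_le_card_of_injOn (s := Finset.univ) (t := S) f
      (fun t _ => by simp [S, hf t])
      (fun t _ t' _ h => Fin.ext (by rw [← (hf t).2, h, (hf t').2]))
    simpa using this
  obtain ⟨C', hC'⟩ := I.G.exists_bColoring_of_card_le C S
    (fun v hv => by
      rw [← deg_eq]
      exact (Finset.mem_filter.1 hv).2.1)
    (by
      have h₁ := I.ell_eq
      have h₂ := I.delta_eq
      simp only [numHighDeg, maxDeg] at h₁ h₂
      rw [threshold, h₁, h₂] at hS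
      exact hS)
  refine ⟨C', fun i => ?_⟩
  obtain ⟨x, hxS, hx⟩ := hC' i
  exact ⟨x, Or.inr (Finset.mem_filter.1 hxS).2, hx⟩

theorem exists_good (h : HasBColoring I.G I.k) : ∃ a < I.k ^ I.ell, ∃ b < I.width ^ I.k,
    ∃ c < (I.delta + 1) ^ (I.k * I.k), I.Good a b c := by
  classical
  obtain ⟨C, hC⟩ := I.exists_bColoring_cand h
  choose x hxc hxi hx using hC
  -- The diagonal entries are dummies; `Col` never reads them because it requires `i ≠ j`.
  have hy : ∀ i j, ∃ y, j ≠ i → I.G.Adj (x i) y ∧ C y = j := fun i j => by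
    by_cases hij : j = i
    · exact ⟨x i, fun h => absurd hij h⟩
    · exact (hx i j hij).imp fun _ h _ => h
  choose y hy using hy
  obtain ⟨a, ha, hda⟩ := Nat.exists_digits_count I.High I.k I.n
    (fun v => if h : v < I.n then C ⟨v, h⟩ else 0) fun v hv => by simp [hv]
  obtain ⟨b, hb, hdb⟩ := Nat.exists_digits I.width I.k
    (fun i => if h : i < I.k then Nat.count I.Cand (x ⟨i, h⟩) else 0) fun i hi => by
      simpa [hi, width] using Nat.count_strict_mono (hxc ⟨i, hi⟩) (x ⟨i, hi⟩).2
  obtain ⟨c, hc, hdc⟩ := Nat.exists_digits (I.delta + 1) (I.k * I.k)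
    (fun m => if h : m / I.k < I.k ∧ m % I.k < I.k then
      Nat.count (I.Adj (x ⟨_, h.1⟩)) (y ⟨_, h.1⟩ ⟨_, h.2⟩) else 0) fun m _ => by
      split_ifs with h
      -- Base `Δ + 1` rather than `Δ`: the dummy `x i` is not its own neighbor, so its rank can
      -- equal the full degree.
      · exact Nat.lt_succ_of_le ((Nat.count_monotone _ (Fin.is_lt _).le).trans
          (I.deg_le_delta (x ⟨_, h.1⟩)))
      · exact Nat.succ_pos _
  have hda' : ∀ v : Fin I.n, I.High v → a / I.k ^ Nat.count I.High v % I.k = C v := fun v hv => by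
    rw [hda v v.2 hv, dif_pos v.2]
  have hdb' : ∀ i : Fin I.k, b / I.width ^ (i : ℕ) % I.width = Nat.count I.Cand (x i) :=
    fun i => by rw [hdb i i.2, dif_pos i.2]
  have hdc' : ∀ i j : Fin I.k, c / (I.delta + 1) ^ (i * I.k + j : ℕ) % (I.delta + 1) =
      Nat.count (I.Adj (x i)) (y i j) := fun i j => by
    have hk : 0 < I.k := i.pos
    have h₁ : (i * I.k + j : ℕ) / I.k = i := by
      rw [Nat.mul_comm, Nat.mul_add_div hk, Nat.div_eq_of_lt j.2, add_zero]
    have h₂ : (i * I.k + j : ℕ) % I.k = j := by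
      rw [Nat.mul_add_mod_self_right, Nat.mod_eq_of_lt j.2]
    have hlt : (i * I.k + j : ℕ) < I.k * I.k := by
      have := Nat.mul_le_mul_right I.k i.2
      rw [Nat.succ_mul] at this
      have := j.2
      omega
    rw [hdc _ hlt, dif_pos ⟨by rw [h₁]; exact i.2, by rw [h₂]; exact j.2⟩]
    simp only [h₁, h₂]
  have hchosen : ∀ (v : Fin I.n) (i : Fin I.k), I.IsChosen b v i ↔ v = x i := fun v i => by
    rw [IsChosen, hdb' i]
    constructor
    · rintro ⟨h, h'⟩
      exact Fin.ext (Nat.count_injective h (hxc i) h')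
    · rintro rfl
      exact ⟨hxc i, rfl⟩
  -- The encoded relation is contained in the graph of `C`, from which uniqueness and properness are
  -- inherited.
  have hcol : ∀ (v : Fin I.n) (j : Fin I.k), I.Col a b c v j → C v = j := by
    rintro v j (⟨h, h'⟩ | h | ⟨i, hi, hij, u, hu, h, h', h''⟩)
    · exact Fin.ext ((hda' v h).symm.trans h')
    · rw [(hchosen v j).1 h, hxi]
    · obtain rfl : u = x ⟨i, hi⟩ := congrArg Fin.val ((hchosen ⟨u, hu⟩ ⟨i, hi⟩).1 h)
      have hyj := hy ⟨i, hi⟩ j fun h => hij (congrArg Fin.val h).symm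
      have hv : v = y ⟨i, hi⟩ j := Fin.ext <|
        Nat.count_injective h' ((I.adj_iff _ _).2 hyj.1) (h''.trans (hdc' ⟨i, hi⟩ j))
      rw [hv, hyj.2]
  refine ⟨a, ha, b, hb, c, hc, fun u hu v hv i hi j hj hui hvj => ⟨?_, fun h hij => ?_⟩,
    fun i hi => ⟨x ⟨i, hi⟩, (x _).2, Or.inr (Or.inl ((hchosen _ ⟨i, hi⟩).2 rfl)),
      fun j hj hji => ⟨y ⟨i, hi⟩ ⟨j, hj⟩, (y _ _).2, ?_, ?_⟩⟩,
    fun v hv hh => ⟨C ⟨v, hv⟩, (C _).2, Or.inl ⟨hh, hda' ⟨v, hv⟩ hh⟩⟩⟩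
  · rintro rfl
    exact congrArg Fin.val
      ((hcol ⟨u, hu⟩ ⟨i, hi⟩ hui).symm.trans (hcol ⟨u, hu⟩ ⟨j, hj⟩ hvj))
  · refine C.valid ((I.adj_iff ⟨u, hu⟩ ⟨v, hv⟩).1 h) ?_
    rw [hcol ⟨u, hu⟩ ⟨i, hi⟩ hui, hcol ⟨v, hv⟩ ⟨j, hj⟩ hvj]
    exact Fin.ext hij
  · exact (I.adj_iff _ _).2 (hy ⟨i, hi⟩ ⟨j, hj⟩ fun h => hji (congrArg Fin.val h)).1
  · refine Or.inr (Or.inr ⟨i, hi, Ne.symm hji, x ⟨i, hi⟩, (x _).2,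
      (hchosen _ ⟨i, hi⟩).2 rfl, ?_, (hdc' ⟨i, hi⟩ ⟨j, hj⟩).symm⟩)
    exact (I.adj_iff _ _).2 (hy ⟨i, hi⟩ ⟨j, hj⟩ fun h => hji (congrArg Fin.val h)).1

theorem le_delta_of_hasBColoring (h : HasBColoring I.G I.k) : I.k ≤ I.delta + 1 := by
  rcases Nat.eq_zero_or_pos I.k with hk | hk
  · omega
  obtain ⟨C, hC⟩ := h
  obtain ⟨x, -, hx⟩ := hC ⟨0, hk⟩
  exact (I.le_deg_of_bVertex hx).trans (Nat.succ_le_succ (I.deg_le_delta x))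

theorem accept_iff : I.Accept ↔ HasBColoring I.G I.k := by
  constructor
  · rintro ⟨-, a, -, b, -, c, -, h⟩
    exact h.hasBColoring
  · intro h
    have hk := I.le_delta_of_hasBColoring h
    rw [Accept, kappa, if_pos hk]
    exact ⟨hk, I.exists_good h⟩

theorem le_n_of_hasBColoring (h : HasBColoring I.G I.k) : I.k ≤ I.n := by
  obtain ⟨C, hC⟩ := h
  choose x hx _ using hC
  simpa using Fintype.card_le_of_injective x fun i j h => by rw [← hx i, h, hx j]

end BInstance

namespace BInstance

/-! ## The running time -/

/-- The bound in which the running time is measured. -/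
noncomputable def bound (I : BInstance) : ℕ :=
  (I.n + 2) * (I.kappa ^ I.ell + 1) * (I.width ^ I.kappa + 1) *
    (I.delta + 1) ^ (I.kappa * I.kappa)

theorem le_bound (I : BInstance) : I.n + 2 ≤ I.bound ∧ I.kappa ^ I.ell ≤ I.bound ∧
    I.width ^ I.kappa ≤ I.bound ∧ (I.delta + 1) ^ (I.kappa * I.kappa) ≤ I.bound := by
  have hD : 1 ≤ (I.delta + 1) ^ (I.kappa * I.kappa) := Nat.one_le_pow _ _ (Nat.succ_pos _)
  rw [bound]
  generalize I.kappa ^ I.ell = a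
  generalize I.width ^ I.kappa = b
  generalize (I.delta + 1) ^ (I.kappa * I.kappa) = c at hD
  refine ⟨?_, ?_, ?_, ?_⟩
  · calc I.n + 2 = (I.n + 2) * 1 * 1 * 1 := by ring
      _ ≤ _ := by gcongr <;> omega
  · calc a ≤ 1 * (a + 1) * 1 * 1 := by omega
      _ ≤ _ := by gcongr <;> omega
  · calc b ≤ 1 * 1 * (b + 1) * 1 := by omega
      _ ≤ _ := by gcongr <;> omega
  · calc c = 1 * 1 * 1 * c := by ring
      _ ≤ _ := by gcongr <;> omega

/-- The instances with at most as many colors as vertices. -/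
abbrev Small : Type := {I : BInstance // I.k ≤ I.n}

end BInstance

/-! ### The program, timed by `bound` -/

namespace RAM

open Context BInstance

noncomputable instance BInstance.Small.context : Context BInstance.Small where
  size := 2
  regs I := I.1.input.reg
  cells I := I.1.input.arr 0
  bound I := I.1.bound
  two_le_bound I := (Nat.le_add_left _ _).trans I.1.le_bound.1

noncomputable instance BInstance.Small.instanceContext : InstanceContext BInstance.Small where
  inst I := I.1
  comp_n := .register ⟨1, fun I => by
    rw [pow_one]; exact (Nat.le_add_right _ _).trans I.1.le_bound.1⟩ 0 (by decide) fun _ => rfl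
  comp_k := .register ⟨1, fun I => by
    rw [pow_one]; exact I.2.trans ((Nat.le_add_right _ _).trans I.1.le_bound.1)⟩ 1 (by decide)
      fun _ => rfl
  cells_eq _ := rfl

theorem DecidesInTime.mono {p : Program} {s : State} {Q : Prop} {T T' : ℕ}
    (h : DecidesInTime p s Q T) (hT : T ≤ T') : DecidesInTime p s Q T' :=
  let ⟨s', t, hr, ht, h⟩ := h
  ⟨s', t, hr, ht.trans hT, h⟩

theorem exists_decidesInTime_bound : ∃ (p : Program) (c : ℕ), ∀ I : BInstance,
    DecidesInTime p I.input (HasBColoring I.G I.k) (I.bound ^ c) := by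
  classical
  have hb : ∀ f : BInstance → ℕ, (∀ I, f I ≤ I.bound) →
      PolyBounded fun I : BInstance.Small => f I.1 := fun f hf =>
    ⟨1, fun I => by rw [pow_one]; exact hf I.1⟩
  obtain ⟨-, T, ⟨c, hT⟩, h⟩ := comp_accept (α := BInstance.Small)
    (hb (fun I => I.kappa ^ I.ell) fun I => I.le_bound.2.1)
    (hb (fun I => I.width ^ I.kappa) fun I => I.le_bound.2.2.1)
    (hb (fun I => (I.delta + 1) ^ (I.kappa * I.kappa)) fun I => I.le_bound.2.2.2)
  obtain ⟨p, hp⟩ := h id 2 fun i hi => hi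
  -- Instances with `k > n` are rejected at once: `k` is then not controlled by the bound. Otherwise
  -- `p` leaves the input registers 0 and 1 intact and puts its answer in register 2.
  refine ⟨.ifLt 0 1 (.const 0 0) (.seq p (.copy 0 2)), c + 2, fun I => ?_⟩
  have h2 : 2 ≤ I.bound := (Nat.le_add_left _ _).trans I.le_bound.1
  have hpow : I.bound ^ c + 2 ≤ I.bound ^ (c + 2) := by
    have h1 : 1 ≤ I.bound ^ c := Nat.one_le_pow _ _ (by omega)
    calc I.bound ^ c + 2 ≤ I.bound ^ c * (2 * 2) := by omega
      _ ≤ I.bound ^ c * (I.bound * I.bound) := by gcongr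
      _ = _ := by ring
  by_cases hk : I.n < I.k
  · refine ⟨_, _, .ifTrue hk (.const _ 0 0), by omega, fun hQ => ?_, fun _ => ?_⟩
    · exact absurd (I.le_n_of_hasBColoring hQ) (by omega)
    · simp [State.setReg]
  · obtain ⟨s', t, hr, ht, hv, -, -⟩ := hp ⟨I, not_lt.1 hk⟩ I.input (fun _ _ => rfl) rfl
    have ht' := ht.trans (hT _)
    change t ≤ I.bound ^ c at ht'
    have hv' : s'.reg 2 = if I.Accept then 1 else 0 := hv
    refine ⟨_, _, .ifFalse hk (.seq hr (.copy s' 0 2)), by omega, fun hQ => ?_, fun hQ => ?_⟩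
    · simp [State.setReg, hv', I.accept_iff, hQ]
    · simp [State.setReg, hv', I.accept_iff, hQ]

end RAM

/-! ### Estimates for `bound` -/

namespace BInstance

variable (I : BInstance)

theorem width_le : I.width ≤ I.ell + I.threshold := by
  classical
  have h : ∀ v, I.Cand v → I.High v ∨ (I.Tight v ∧ Nat.count I.Tight v < I.threshold) :=
    fun _ h => h
  rw [width, Nat.count_eq_card_filter_range, ell, Nat.count_eq_card_filter_range]
  have hsub : (Finset.range I.n).filter I.Cand ⊆ (Finset.range I.n).filter I.High ∪
      (Finset.range I.n).filter fun v => I.Tight v ∧ Nat.count I.Tight v < I.threshold := by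
    intro v hv
    rw [Finset.mem_filter] at hv
    simp only [Finset.mem_union, Finset.mem_filter, hv.1, true_and]
    exact h v hv.2
  refine (Finset.card_le_card hsub).trans ((Finset.card_union_le _ _).trans
    (Nat.add_le_add_left ?_ _))
  have := Finset.card_le_card_of_injOn
    (s := (Finset.range I.n).filter fun v => I.Tight v ∧ Nat.count I.Tight v < I.threshold)
    (t := Finset.range I.threshold) (Nat.count I.Tight)
    (fun v hv => by
      simp only [Finset.coe_filter, Set.mem_ofPred_eq] at hv
      simpa using hv.2.2)
    (fun v hv w hw h => by
      simp only [Finset.coe_filter, Set.mem_ofPred_eq] at hv hw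
      exact Nat.count_injective hv.2.1 hw.2.1 h)
  rwa [Finset.card_range] at this

theorem width_le_two_pow : I.width ≤ 2 ^ (2 * I.ell + I.k + 3 * I.delta) := by
  have hd : I.delta + 1 ≤ 2 ^ I.delta := Nat.lt_two_pow_self
  calc I.width ≤ I.ell + (I.ell + I.k) * ((I.delta + 1) * (I.delta + 1) * (I.delta + 1)) :=
        I.width_le
    _ ≤ I.ell * ((I.delta + 1) * (I.delta + 1) * (I.delta + 1)) +
        (I.ell + I.k) * ((I.delta + 1) * (I.delta + 1) * (I.delta + 1)) :=
        Nat.add_le_add_right (Nat.le_mul_of_pos_right _ (by positivity)) _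
    _ = (2 * I.ell + I.k) * ((I.delta + 1) * (I.delta + 1) * (I.delta + 1)) := by ring
    _ ≤ 2 ^ (2 * I.ell + I.k) * (2 ^ I.delta * 2 ^ I.delta * 2 ^ I.delta) := by
        gcongr
        exact Nat.lt_two_pow_self.le
    _ = _ := by ring

theorem bound_le : I.bound ≤ (I.n + 2) ^ 3 ∨ (0 < I.k ∧ 0 < I.delta ∧ I.k ≤ I.delta + 1 ∧
    I.bound ≤ (I.n + 2) ^ 3 *
      2 ^ (I.k * (3 * I.ell + I.k + 3 * I.delta) + I.delta * (I.k * I.k))) := by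
  have hw : I.width ≤ I.n := by
    classical
    exact Nat.count_le _
  by_cases hd : I.kappa = 0 ∨ (I.kappa = 1 ∧ I.delta = 0)
  · left
    have h₁ : I.kappa ^ I.ell ≤ 1 := by
      rcases hd with h | ⟨h, -⟩
      · rw [h]; exact pow_le_one' (by omega) _
      · simp [h]
    have h₂ : I.width ^ I.kappa ≤ I.n + 1 := by
      rcases hd with h | ⟨h, -⟩ <;> rw [h]
      · simp
      · rw [pow_one]; omega
    have h₃ : (I.delta + 1) ^ (I.kappa * I.kappa) = 1 := by
      rcases hd with h | ⟨h, h'⟩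
      · simp [h]
      · simp [h']
    calc I.bound ≤ (I.n + 2) * (I.n + 2) * (I.n + 2) * 1 := by
          rw [bound, h₃]
          exact Nat.mul_le_mul_right _
            (Nat.mul_le_mul (Nat.mul_le_mul_left _ (by omega)) (by omega))
      _ = _ := by ring
  · right
    have hk : I.k ≤ I.delta + 1 := by
      by_contra h
      exact hd (Or.inl (if_neg h))
    have hκ : I.kappa = I.k := if_pos hk
    rw [hκ] at hd
    refine ⟨by omega, by omega, hk, ?_⟩
    have h₁ : I.k ^ I.ell + 1 ≤ 2 * 2 ^ (I.k * I.ell) := by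
      have : I.k ^ I.ell ≤ 2 ^ (I.k * I.ell) := by
        rw [pow_mul]
        exact Nat.pow_le_pow_left Nat.lt_two_pow_self.le _
      have := Nat.one_le_two_pow (n := I.k * I.ell)
      omega
    have h₂ : I.width ^ I.k + 1 ≤ 2 * 2 ^ ((2 * I.ell + I.k + 3 * I.delta) * I.k) := by
      have : I.width ^ I.k ≤ 2 ^ ((2 * I.ell + I.k + 3 * I.delta) * I.k) := by
        rw [pow_mul]
        exact Nat.pow_le_pow_left I.width_le_two_pow _
      have := Nat.one_le_two_pow (n := (2 * I.ell + I.k + 3 * I.delta) * I.k)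
      omega
    have h₃ : (I.delta + 1) ^ (I.k * I.k) ≤ 2 ^ (I.delta * (I.k * I.k)) := by
      rw [pow_mul 2]
      exact Nat.pow_le_pow_left Nat.lt_two_pow_self _
    have e : 2 ^ (I.k * (3 * I.ell + I.k + 3 * I.delta) + I.delta * (I.k * I.k)) =
        2 ^ (I.k * I.ell) * 2 ^ ((2 * I.ell + I.k + 3 * I.delta) * I.k) *
          2 ^ (I.delta * (I.k * I.k)) := by
      rw [← pow_add, ← pow_add]
      congr 1
      ring
    rw [bound, hκ, e]
    generalize 2 ^ (I.k * I.ell) = A at *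
    generalize 2 ^ ((2 * I.ell + I.k + 3 * I.delta) * I.k) = B at *
    generalize 2 ^ (I.delta * (I.k * I.k)) = D at *
    calc _ ≤ (I.n + 2) * (2 * A) * (2 * B) * D := by gcongr
      _ = (I.n + 2) * 2 * 2 * (A * B * D) := by ring
      _ ≤ (I.n + 2) * (I.n + 2) * (I.n + 2) * (A * B * D) := by gcongr <;> omega
      _ = _ := by ring

theorem exponent_le_of_lt {k d l : ℕ} (hk : 0 < k) (hd : 0 < d) (hkd : k ≤ d + 1) (hkl : k < l) :
    k * (3 * l + k + 3 * d) + d * (k * k) ≤ 20 * (l * d * min l d ^ (l + 1)) := by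
  have hm : 1 ≤ min l d := le_min (by omega) hd
  -- Here `k < l` and `k ≤ d + 1 ≤ 2 * d`. Of the large power of the minimum only its square is
  -- needed.
  have hkm : k ≤ 2 * min l d := by omega
  have hpow : min l d ^ 2 ≤ min l d ^ (l + 1) := Nat.pow_le_pow_right hm (by omega)
  have hl : 1 ≤ l := by omega
  generalize min l d = m at *
  have h₁ : 3 * l + k + 3 * d ≤ 7 * (l * d) := by
    have : l ≤ l * d := Nat.le_mul_of_pos_right l hd
    have : d ≤ l * d := Nat.le_mul_of_pos_left d hl
    omega
  calc k * (3 * l + k + 3 * d) + d * (k * k)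
      ≤ (2 * m * m) * (7 * (l * d)) + (l * d) * ((2 * m) * (2 * m)) := by
        gcongr
        · exact hkm.trans (Nat.le_mul_of_pos_right _ hm)
        · exact Nat.le_mul_of_pos_left d hl
    _ = 18 * (l * d * m ^ 2) := by ring
    _ ≤ 20 * (l * d * m ^ (l + 1)) := by gcongr; omega

theorem exponent_le_of_le {k d l : ℕ} (hk : 0 < k) (hd : 0 < d) (hkd : k ≤ d + 1) (hkl : l ≤ k) :
    k * (3 * l + k + 3 * d) + d * (k * k) ≤ 20 * (min k (d + 1) ^ 4 * d) := by
  rw [min_eq_left hkd]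
  -- Both `l` and `k` are at most `d + 1 ≤ 2 * d`.
  have h₁ : 3 * l + k + 3 * d ≤ 11 * d := by omega
  have h₂ : k ≤ k ^ 4 := Nat.le_self_pow (by norm_num) k
  have h₃ : k * k ≤ k ^ 4 := by
    rw [← pow_two]
    exact Nat.pow_le_pow_right hk (by norm_num)
  calc k * (3 * l + k + 3 * d) + d * (k * k) ≤ k ^ 4 * (11 * d) + d * k ^ 4 := by gcongr
    _ ≤ 20 * (k ^ 4 * d) := by linarith [Nat.zero_le (k ^ 4 * d)]

/-- The product of a polynomial and an exponential becomes a sum through `x * y ≤ y ^ 2 + x ^ 2`,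
which doubles the exponents: 20 becomes 40, and 3 becomes 6. -/
theorem bound_pow_le {X : ℕ} (c : ℕ) (hX : 0 < I.k → 0 < I.delta → I.k ≤ I.delta + 1 →
      I.k * (3 * I.ell + I.k + 3 * I.delta) + I.delta * (I.k * I.k) ≤ 20 * X) :
    I.bound ^ c ≤ 2 ^ (40 * c * X) + (I.n + 2) ^ (40 * c) := by
  have h : I.bound ≤ (I.n + 2) ^ 3 * 2 ^ (20 * X) := by
    rcases I.bound_le with h | ⟨h₁, h₂, h₃, h⟩
    · exact h.trans (Nat.le_mul_of_pos_right _ (by positivity))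
    · exact h.trans (Nat.mul_le_mul_left _ (Nat.pow_le_pow_right two_pos (hX h₁ h₂ h₃)))
  have hxy : ∀ x y : ℕ, x * y ≤ y ^ 2 + x ^ 2 := fun x y => by
    rcases le_total x y with h | h
    · exact (Nat.mul_le_mul_right y h).trans (by rw [pow_two]; omega)
    · exact (Nat.mul_le_mul_left x h).trans (by rw [pow_two x]; omega)
  calc I.bound ^ c ≤ ((I.n + 2) ^ 3 * 2 ^ (20 * X)) ^ c := Nat.pow_le_pow_left h c
    _ = (I.n + 2) ^ (3 * c) * 2 ^ (20 * X * c) := by rw [mul_pow, ← pow_mul, ← pow_mul]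
    _ ≤ (2 ^ (20 * X * c)) ^ 2 + ((I.n + 2) ^ (3 * c)) ^ 2 := hxy _ _
    _ = 2 ^ (40 * c * X) + (I.n + 2) ^ (6 * c) := by
      rw [← pow_mul, ← pow_mul]
      congr 2 <;> ring
    _ ≤ _ := Nat.add_le_add_left (Nat.pow_le_pow_right (by omega) (by omega)) _

end BInstance

/-! ### From the explicit bounds to fixed-parameter tractability -/

theorem Primrec.nat_pow : Primrec₂ fun a n : ℕ => a ^ n := by
  refine (Primrec.nat_rec (f := fun _ : ℕ => 1) (g := fun a (p : ℕ × ℕ) => p.2 * a)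
    (Primrec.const 1) (Primrec.nat_mul.comp (Primrec.snd.comp Primrec.snd) Primrec.fst)).of_eq
    fun a n => ?_
  induction n with
  | zero => rfl
  | succ n ih => rw [pow_succ, ← ih]

/-- With `q = Δ + ℓ`, the term `q ^ (q + 3)` dominates the exponent for `ℓ > k` and `(q + 1) ^ 5`
the one for `ℓ ≤ k`; the summand `2 ^ c` pays for `n + 2 ≤ 2 * length`. -/
theorem computable_two_pow_tower (c : ℕ) :
    Computable fun q : ℕ => 2 ^ (c * (q ^ (q + 3) + (q + 1) ^ 5)) + 2 ^ c := by
  refine Primrec.to_comp ?_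
  have h₁ : Primrec fun q : ℕ => q ^ (q + 3) :=
    Primrec.nat_pow.comp Primrec.id (Primrec.nat_add.comp Primrec.id (Primrec.const 3))
  have h₂ : Primrec fun q : ℕ => (q + 1) ^ 5 := Primrec.nat_pow.comp Primrec.succ (Primrec.const 5)
  exact Primrec.nat_add.comp (Primrec.nat_pow.comp (Primrec.const 2)
    (Primrec.nat_mul.comp (Primrec.const c) (Primrec.nat_add.comp h₁ h₂))) (Primrec.const _)

theorem exists_decidesInTime : ∃ (p : RAM.Program) (c : ℕ),
    ∀ (n : ℕ) (G : SimpleGraph (Fin n)) (k Δ ℓ : ℕ), Δ = maxDeg G → ℓ = numHighDeg G k →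
      (k < ℓ → RAM.DecidesInTime p (BInstance.input ⟨n, G, k⟩) (HasBColoring G k)
        (2 ^ (c * (ℓ * Δ * min ℓ Δ ^ (ℓ + 1))) + (n + 2) ^ c)) ∧
      (ℓ ≤ k → RAM.DecidesInTime p (BInstance.input ⟨n, G, k⟩) (HasBColoring G k)
        (2 ^ (c * (min k (Δ + 1) ^ 4 * Δ)) + (n + 2) ^ c)) := by
  obtain ⟨p, c, h⟩ := RAM.exists_decidesInTime_bound
  refine ⟨p, 40 * c, fun n G k Δ ℓ hΔ hℓ => ?_⟩
  have hΔ' : Δ = (⟨n, G, k⟩ : BInstance).delta := hΔ.trans (BInstance.delta_eq ⟨n, G, k⟩).symm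
  have hℓ' : ℓ = (⟨n, G, k⟩ : BInstance).ell := hℓ.trans (BInstance.ell_eq ⟨n, G, k⟩).symm
  constructor <;> intro hlt <;> refine (h ⟨n, G, k⟩).mono (BInstance.bound_pow_le _ c ?_) <;>
    rw [← hΔ', ← hℓ'] <;> intro h₁ h₂ h₃
  · exact BInstance.exponent_le_of_lt h₁ h₂ h₃ hlt
  · exact BInstance.exponent_le_of_le h₁ h₂ h₃ hlt

theorem isFPT_of_decidesInTime {p : RAM.Program} {c : ℕ}
    (h : ∀ (n : ℕ) (G : SimpleGraph (Fin n)) (k Δ ℓ : ℕ), Δ = maxDeg G → ℓ = numHighDeg G k →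
      (k < ℓ → RAM.DecidesInTime p (BInstance.input ⟨n, G, k⟩) (HasBColoring G k)
        (2 ^ (c * (ℓ * Δ * min ℓ Δ ^ (ℓ + 1))) + (n + 2) ^ c)) ∧
      (ℓ ≤ k → RAM.DecidesInTime p (BInstance.input ⟨n, G, k⟩) (HasBColoring G k)
        (2 ^ (c * (min k (Δ + 1) ^ 4 * Δ)) + (n + 2) ^ c))) :
    RAM.IsFPT BInstance.input BInstance.length
      (fun I => maxDeg I.G + numHighDeg I.G I.k) (fun I => HasBColoring I.G I.k) := by
  refine ⟨p, _, c, computable_two_pow_tower c, fun I => ?_⟩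
  have hlen : I.n + 2 ≤ 2 * I.length := by
    rw [BInstance.length]
    rcases Nat.lt_or_ge I.n 1 with h | h
    · omega
    · have : I.n ≤ I.n ^ 2 := Nat.le_self_pow (by norm_num) _
      omega
  have key : ∀ X F : ℕ, X ≤ F →
      2 ^ (c * X) + (I.n + 2) ^ c ≤ (2 ^ (c * F) + 2 ^ c) * I.length ^ c := by
    intro X F hXF
    rw [add_mul, ← mul_pow]
    refine Nat.add_le_add ?_ (Nat.pow_le_pow_left hlen c)
    exact (Nat.pow_le_pow_right two_pos (Nat.mul_le_mul_left c hXF)).trans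
      (Nat.le_mul_of_pos_right _ (Nat.pow_pos (Nat.succ_pos _)))
  obtain ⟨h₁, h₂⟩ := h I.n I.G I.k _ _ rfl rfl
  beta_reduce
  generalize maxDeg I.G = d at *
  generalize numHighDeg I.G I.k = l at *
  rcases Nat.lt_or_ge I.k l with hk | hk
  · refine (h₁ hk).mono (key _ _ (le_trans ?_ (Nat.le_add_right _ _)))
    calc l * d * min l d ^ (l + 1) ≤ (d + l) * (d + l) * (d + l) ^ (d + l + 1) := by
          refine Nat.mul_le_mul (Nat.mul_le_mul (by omega) (by omega)) ?_
          exact (Nat.pow_le_pow_left (by omega) _).trans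
            (Nat.pow_le_pow_right (by omega : 0 < d + l) (by omega))
      _ = _ := by ring
  · refine (h₂ hk).mono (key _ _ (le_trans ?_ (Nat.le_add_left _ _)))
    calc min I.k (d + 1) ^ 4 * d ≤ (d + l + 1) ^ 4 * (d + l + 1) := by
          gcongr <;> omega
      _ = _ := by ring

theorem mainTheorem9 :
    RAM.IsFPT BInstance.input BInstance.length
      (fun I => maxDeg I.G + numHighDeg I.G I.k) (fun I => HasBColoring I.G I.k) ∧
    ∃ (p : RAM.Program) (c : ℕ), ∀ (n : ℕ) (G : SimpleGraph (Fin n)) (k Δ ℓ : ℕ),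
      Δ = maxDeg G → ℓ = numHighDeg G k →
      (k < ℓ → RAM.DecidesInTime p (BInstance.input ⟨n, G, k⟩) (HasBColoring G k)
        (2 ^ (c * (ℓ * Δ * min ℓ Δ ^ (ℓ + 1))) + (n + 2) ^ c)) ∧
      (ℓ ≤ k → RAM.DecidesInTime p (BInstance.input ⟨n, G, k⟩) (HasBColoring G k)
        (2 ^ (c * (min k (Δ + 1) ^ 4 * Δ)) + (n + 2) ^ c)) := by
  obtain ⟨p, c, h⟩ := exists_decidesInTime
  exact ⟨isFPT_of_decidesInTime h, p, c, h⟩
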